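/- Let $\varphi:[0,\infty)\to[0,\infty)$ be increasing (i.e. nondecreasing), subadditive and continuous, with $\varphi(0)=0$ and $\varphi^\infty:=\lim_{t\to\infty}\varphi(t)/t=0$. Let $\Omega\subset\mathbb{R}^m$ be an open set (not necessarily bounded) with Lipschitz boundary, i.e. near each point of $\partial\Omega$ the set $\Omega$ is, in suitable orthonormal coordinates, the strict epigraph of a Lipschitz function. A function $u\in L^1(\Omega)$ belongs to $BV(\Omega)$ if its distributional gradient $Du$ is a finite $\mathbb{R}^m$-valued Radon measure on $\Omega$. A sequence $(u^i)$ in $BV(\Omega)$ converges weakly* to $u\in BV(\Omega)$ if $u^i\to u$ in $L^1(\Omega)$ and $\int_\Omega f\,dDu^i\to\int_\Omega f\,dDu$ for every $f\in C_0(\Omega)$, the continuous real-valued functions on $\Omega$ that vanish at infinity on $\Omega$. For $u\in BV(\Omega)$ define $$TV^\varphi_c(u):=\inf\Big\{\liminf_{i\to\infty}\int_\Omega\varphi(|\nabla u^i(x)|)\,dx \;:\; u^i\in C^1(\Omega)\cap BV(\Omega),\ u^i\to u \text{ weakly* in } BV(\Omega)\Big\}\in[0,\infty].$$ Then $TV^\varphi_c(u)=0$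 for every $u\in BV(\Omega)$. -/

import Mathlib

open MeasureTheory Filter Topology
open scoped NNReal ENNReal ContDiff ZeroAtInfty

noncomputable section

namespace TVphi

/-- The energies: increasing, subadditive, continuous functions `[0,∞) → [0,∞)` vanishing at `0`
with recession slope `lim_{t → ∞} φ(t)/t` equal to `0`. -/
structure IsEnergy (φ : ℝ≥0 → ℝ≥0) : Prop where
  monotone : Monotone φ
  subadditive : ∀ s t, φ (s + t) ≤ φ s + φ t
  continuous : Continuous φ
  map_zero : φ 0 = 0
  recession_zero : Tendsto (fun t : ℝ≥0 => φ t / t) atTop (𝓝 0)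

variable {m : ℕ}

/-- `Ω` has Lipschitz boundary: around each boundary point, in suitable orthonormal coordinates
(`e` being the last coordinate direction), `Ω` is the strict epigraph of a Lipschitz function of
the remaining coordinates. -/
def HasLipschitzBoundary (Ω : Set (EuclideanSpace ℝ (Fin m))) : Prop :=
  ∀ x ∈ frontier Ω, ∃ r > (0 : ℝ), ∃ e : EuclideanSpace ℝ (Fin m), ‖e‖ = 1 ∧
    ∃ (K : ℝ≥0) (γ : ((ℝ ∙ e)ᗮ : Submodule ℝ (EuclideanSpace ℝ (Fin m))) → ℝ), LipschitzWith K γ ∧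
      ∀ y ∈ Metric.ball x r, y ∈ Ω ↔ γ ((ℝ ∙ e)ᗮ.orthogonalProjectionOnto y) < inner ℝ e y

/-- `μ` is the distributional gradient `Du` of `u` on `Ω`, as a finite `ℝᵐ`-valued Radon measure
on `Ω`. Measures on `Ω` are represented by measures on `ℝᵐ` for which the complement of `Ω` is
null. The values of `u` outside `Ω` are irrelevant. -/
structure IsGradientMeasure (Ω : Set (EuclideanSpace ℝ (Fin m)))
    (u : EuclideanSpace ℝ (Fin m) → ℝ)
    (μ : VectorMeasure (EuclideanSpace ℝ (Fin m)) (EuclideanSpace ℝ (Fin m))) : Prop where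
  finite : μ.variation Set.univ < ⊤
  concentrated : μ.variation Ωᶜ = 0
  integral_eq : ∀ ψ : EuclideanSpace ℝ (Fin m) → ℝ, ContDiff ℝ ∞ ψ → HasCompactSupport ψ →
    tsupport ψ ⊆ Ω → ∫ x in Ω, u x • gradient ψ x = -∫ᵛ x, ψ x ∂•μ

/-- `u ∈ BV(Ω)`. -/
def IsBV (Ω : Set (EuclideanSpace ℝ (Fin m))) (u : EuclideanSpace ℝ (Fin m) → ℝ) : Prop :=
  IntegrableOn u Ω ∧ ∃ μ, IsGradientMeasure Ω u μ

/-- The sequence `v` in `BV(Ω)` converges weakly* to `u` in `BV(Ω)`: `v i → u` in `L¹(Ω)` and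
`D(v i) → Du` weakly* in the dual `M(Ω; ℝᵐ)` of `C₀(Ω; ℝᵐ)`. Here `C₀(Ω)`, extended by zero,
consists of the functions in `C₀(ℝᵐ)` that vanish outside of `Ω`. -/
def WeakStarTendsto (Ω : Set (EuclideanSpace ℝ (Fin m)))
    (v : ℕ → EuclideanSpace ℝ (Fin m) → ℝ) (u : EuclideanSpace ℝ (Fin m) → ℝ) : Prop :=
  (∀ i, IntegrableOn (v i) Ω) ∧ IntegrableOn u Ω ∧
  Tendsto (fun i => eLpNorm (v i - u) 1 (volume.restrict Ω)) atTop (𝓝 0) ∧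
  ∃ (ν : ℕ → VectorMeasure (EuclideanSpace ℝ (Fin m)) (EuclideanSpace ℝ (Fin m)))
    (μ : VectorMeasure (EuclideanSpace ℝ (Fin m)) (EuclideanSpace ℝ (Fin m))),
    (∀ i, IsGradientMeasure Ω (v i) (ν i)) ∧ IsGradientMeasure Ω u μ ∧
    ∀ f : C₀(EuclideanSpace ℝ (Fin m), ℝ), (∀ x ∉ Ω, f x = 0) →
      Tendsto (fun i => ∫ᵛ x, f x ∂•(ν i)) atTop (𝓝 (∫ᵛ x, f x ∂•μ))

/-- The energy `∫_Ω φ(|∇u|) dx`, meant for `u ∈ C¹(Ω)`. -/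
def smoothEnergy (φ : ℝ≥0 → ℝ≥0) (Ω : Set (EuclideanSpace ℝ (Fin m)))
    (u : EuclideanSpace ℝ (Fin m) → ℝ) : ℝ≥0∞ :=
  ∫⁻ x in Ω, (φ ‖gradient u x‖₊ : ℝ≥0∞)

/-- The weak* lower semicontinuous envelope `TV^φ_c`: the infimum of `liminf_i ∫_Ω φ(|∇v_i|) dx`
over all sequences of `C¹(Ω)` functions converging weakly* to `u` in `BV(Ω)`. -/
def TVc (φ : ℝ≥0 → ℝ≥0) (Ω : Set (EuclideanSpace ℝ (Fin m)))
    (u : EuclideanSpace ℝ (Fin m) → ℝ) : ℝ≥0∞ :=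
  ⨅ (v : ℕ → EuclideanSpace ℝ (Fin m) → ℝ) (_ : ∀ i, ContDiffOn ℝ 1 (v i) Ω)
    (_ : WeakStarTendsto Ω v u), liminf (fun i => smoothEnergy φ Ω (v i)) atTop

end TVphi

end

/-!
The relaxed energy vanishes because an energy with zero recession slope charges steep jumps
arbitrarily little: it is cheap to climb by short, steep steps.

Let `u ∈ BV(Ω)` have gradient measure `μ`. By a Meyers–Serrin argument
(`TVphi.exists_contDiffOn_approx`), `u` is close in `L¹(Ω)` to a `C¹` function `v₁` with
`∫ |∇v₁| ≤ |μ|(Ω) + ε`. Composing with a `C¹` function on the line that is constant near `0`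
(`TVphi.exists_flat_approx`) yields `v₂` that vanishes outside of a set of finite measure, which is
needed since `φ(|∇v₁|)` need not be integrable when `Ω` has infinite measure.

Next, `v₂` is composed with a staircase `s ↦ h G(s / h)` whose slope is `ρ (s / h - a)`, where `ρ`
is a probability density on the circle `ℝ / ℤ`, bounded by `2k` and supported in a set of measure
at most `2 / k`. The composition is uniformly `h`-close to `v₂`, and its gradient is
`ρ (v₂ / h - a) ∇v₂`. Averaged over the offset `a ∈ ℝ / ℤ`, the total variation is `∫ |∇v₂|`, and
the energy is at most `(2 / k) ∫ φ(2k |∇v₂|)`. The latter tends to `0` as `k → ∞` by dominated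
convergence: pointwise because the recession slope of `φ` is zero, and with dominating function
`4 φ(|∇v₂|)` by subadditivity. So some offset makes the energy small and keeps the total variation
bounded (`TVphi.exists_staircase_approx`).

This gives `C¹` functions converging to `u` in `L¹(Ω)` with bounded total variations and with
energies tending to `0`. Bounded total variations upgrade the `L¹` convergence to weak* convergence
in `BV(Ω)` (`TVphi.tendsto_integral_gradientMeasure`), so the sequence is a competitor for the
relaxed energy of `u`.
-/

namespace TVphi

/-! ### Gradients, vector measures with density, and `C¹` functions as `BV` functions -/

section GradientCalculus

variable {E : Type*} [NormedAddCommGroup E] [InnerProductSpace ℝ E] [CompleteSpace E]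

lemma inner_gradient_right (f : E → ℝ) (x e : E) : inner ℝ e (gradient f x) = fderiv ℝ f x e := by
  rw [real_inner_comm, ← InnerProductSpace.toDual_apply_apply (𝕜 := ℝ), toDual_gradient]

lemma continuous_gradient {f : E → ℝ} (hf : ContDiff ℝ 1 f) : Continuous (gradient f) :=
  (InnerProductSpace.toDual ℝ E).symm.continuous.comp (hf.continuous_fderiv one_ne_zero)

lemma continuousOn_gradient {f : E → ℝ} {Ω : Set E} (hΩ : IsOpen Ω) (hf : ContDiffOn ℝ 1 f Ω) :
    ContinuousOn (gradient f) Ω :=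
  (InnerProductSpace.toDual ℝ E).symm.continuous.comp_continuousOn
    (hf.continuousOn_fderiv_of_isOpen hΩ le_rfl)

lemma gradient_eq_zero_of_notMem_tsupport {f : E → ℝ} {x : E} (hx : x ∉ tsupport f) :
    gradient f x = 0 := by
  have : fderiv ℝ f x = 0 := by
    by_contra h
    exact hx (support_fderiv_subset ℝ h)
  simp [gradient, this]

lemma hasCompactSupport_gradient {f : E → ℝ} (hf : HasCompactSupport f) :
    HasCompactSupport (gradient f) :=
  hf.mono' fun _ hx => by
    by_contra h
    exact hx (gradient_eq_zero_of_notMem_tsupport h)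

end GradientCalculus

section VectorMeasureIntegral

open VectorMeasure

variable {X F : Type*} [MeasurableSpace X] [NormedAddCommGroup F] [NormedSpace ℝ F]

lemma enorm_vectorMeasure_integral_le (μ : VectorMeasure X F) (f : X → ℝ) :
    ‖∫ᵛ x, f x ∂•μ‖ₑ ≤ ∫⁻ x, ‖f x‖ₑ ∂μ.variation := by
  simpa using enorm_integral_le_lintegral_enorm_transpose (f := f) (μ := μ)
    (B := ContinuousLinearMap.lsmul ℝ ℝ)

lemma integrable_simpleFunc_smul {μ : Measure X} {f : X → F} (hf : Integrable f μ)
    (s : SimpleFunc X ℝ) : Integrable (fun x => s x • f x) μ := by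
  obtain ⟨D, hD⟩ := s.exists_forall_norm_le
  exact hf.bdd_smul D s.stronglyMeasurable.aestronglyMeasurable (Eventually.of_forall hD)

variable [CompleteSpace F]

lemma variation_withDensityᵥ_univ_lt_top {μ : Measure X} {f : X → F} (hf : Integrable f μ) :
    (μ.withDensityᵥ f).variation Set.univ < ⊤ := by
  rw [Measure.variation_withDensityᵥ hf, withDensity_apply _ MeasurableSet.univ,
    Measure.restrict_univ]
  exact hf.2

lemma integral_simpleFunc_withDensityᵥ {μ : Measure X} {f : X → F} (hf : Integrable f μ)
    (s : SimpleFunc X ℝ) : ∫ᵛ x, s x ∂•(μ.withDensityᵥ f) = ∫ x, s x • f x ∂μ := by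
  have hfin : IsFiniteMeasure (μ.withDensityᵥ f).variation :=
    ⟨variation_withDensityᵥ_univ_lt_top hf⟩
  induction s using SimpleFunc.induction with
  | const c hs =>
    rename_i s
    have h1 : (fun x => (SimpleFunc.piecewise s hs (SimpleFunc.const X c)
        (SimpleFunc.const X 0)) x) = s.indicator fun _ => c := by
      ext x
      by_cases hx : x ∈ s <;> simp [hx]
    have h2 : (fun x => (SimpleFunc.piecewise s hs (SimpleFunc.const X c)
        (SimpleFunc.const X 0)) x • f x) = s.indicator fun x => c • f x := by
      ext x
      by_cases hx : x ∈ s <;> simp [hx]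
    rw [h1, h2, VectorMeasure.integral_indicator hs, VectorMeasure.setIntegral_const,
      MeasureTheory.integral_indicator hs, MeasureTheory.integral_smul,
      withDensityᵥ_apply hf hs]
    rfl
  | add _ h₁ h₂ =>
    rename_i s t _
    simp only [SimpleFunc.coe_add, Pi.add_apply, add_smul]
    rw [VectorMeasure.integral_fun_add s.integrable_of_isFiniteMeasure
      t.integrable_of_isFiniteMeasure, h₁, h₂,
      MeasureTheory.integral_add (integrable_simpleFunc_smul hf s)
        (integrable_simpleFunc_smul hf t)]

/-- Integration of a bounded function against the vector measure with density `f` is integration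
of its product with `f`. -/
lemma integral_withDensityᵥ {μ : Measure X} {f : X → F} (hf : Integrable f μ) {ψ : X → ℝ}
    (hψ : StronglyMeasurable ψ) {C : ℝ} (hC : ∀ x, ‖ψ x‖ ≤ C) :
    ∫ᵛ x, ψ x ∂•(μ.withDensityᵥ f) = ∫ x, ψ x • f x ∂μ := by
  have hfin : IsFiniteMeasure (μ.withDensityᵥ f).variation :=
    ⟨variation_withDensityᵥ_univ_lt_top hf⟩
  rcases isEmpty_or_nonempty X with hX | ⟨⟨x₀⟩⟩
  · have : ψ = (0 : SimpleFunc X ℝ) := Subsingleton.elim _ _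
    simp [this]
  have hC0 : 0 ≤ C := (norm_nonneg _).trans (hC x₀)
  have hlim : ∀ x, Tendsto (fun n => hψ.approxBounded C n x) atTop (𝓝 (ψ x)) := fun x =>
    hψ.tendsto_approxBounded_of_norm_le (hC x)
  have hbd : ∀ n x, ‖hψ.approxBounded C n x‖ ≤ C := fun n x => hψ.norm_approxBounded_le hC0 n x
  have h1 : Tendsto (fun n => ∫ᵛ x, hψ.approxBounded C n x ∂•(μ.withDensityᵥ f)) atTop
      (𝓝 (∫ᵛ x, ψ x ∂•(μ.withDensityᵥ f))) := by
    apply VectorMeasure.tendsto_integral_of_dominated_convergence (fun _ => C)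
    · exact fun n => (hψ.approxBounded C n).stronglyMeasurable.aestronglyMeasurable
    · exact integrable_const C
    · exact fun n => Eventually.of_forall (hbd n)
    · exact Eventually.of_forall hlim
  have h2 : Tendsto (fun n => ∫ x, hψ.approxBounded C n x • f x ∂μ) atTop
      (𝓝 (∫ x, ψ x • f x ∂μ)) := by
    apply MeasureTheory.tendsto_integral_of_dominated_convergence (fun x => C * ‖f x‖)
    · exact fun n => (integrable_simpleFunc_smul hf _).1
    · exact hf.norm.const_mul C
    · intro n
      filter_upwards with x
      rw [norm_smul]
      gcongr
      exact hbd n x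
    · exact Eventually.of_forall fun x => (hlim x).smul_const _
  refine tendsto_nhds_unique h1 (h2.congr fun n => ?_)
  exact (integral_simpleFunc_withDensityᵥ hf _).symm

end VectorMeasureIntegral

section GradientMeasure

variable {m : ℕ} {Ω : Set (EuclideanSpace ℝ (Fin m))} {u v : EuclideanSpace ℝ (Fin m) → ℝ}

lemma integrableOn_gradient (hΩ : IsOpen Ω) (hv : ContDiffOn ℝ 1 v Ω)
    (hfin : ∫⁻ x in Ω, ‖gradient v x‖ₑ < ⊤) : IntegrableOn (gradient v) Ω :=
  ⟨(continuousOn_gradient hΩ hv).aestronglyMeasurable hΩ.measurableSet, hfin⟩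

lemma integral_smul_gradient_eq_neg (hΩ : IsOpen Ω) (hv : ContDiffOn ℝ 1 v Ω)
    (hint : IntegrableOn v Ω) (hgrad : IntegrableOn (gradient v) Ω)
    {ψ : EuclideanSpace ℝ (Fin m) → ℝ} (hψ : ContDiff ℝ 1 ψ) (hcpt : HasCompactSupport ψ)
    (hsupp : tsupport ψ ⊆ Ω) :
    ∫ x in Ω, v x • gradient ψ x = -∫ x in Ω, ψ x • gradient v x := by
  obtain ⟨C, hC⟩ := hψ.continuous.bounded_above_of_compact_support hcpt
  obtain ⟨D, hD⟩ := (continuous_gradient hψ).bounded_above_of_compact_support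
    (hasCompactSupport_gradient hcpt)
  have hz : ∀ x ∉ Ω, ψ x = 0 := fun x hx => image_eq_zero_of_notMem_tsupport fun h => hx (hsupp h)
  have hz' : ∀ x ∉ Ω, gradient ψ x = 0 := fun x hx =>
    gradient_eq_zero_of_notMem_tsupport fun h => hx (hsupp h)
  have i1 : IntegrableOn (fun x => v x • gradient ψ x) Ω :=
    hint.smul_bdd D (continuous_gradient hψ).aestronglyMeasurable.restrict
      (Eventually.of_forall hD)
  have i2 : IntegrableOn (fun x => ψ x • gradient v x) Ω :=
    hgrad.bdd_smul C hψ.continuous.aestronglyMeasurable.restrict (Eventually.of_forall hC)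
  have i3 : IntegrableOn (fun x => v x * ψ x) Ω :=
    hint.mul_bdd hψ.continuous.aestronglyMeasurable.restrict (Eventually.of_forall hC)
  refine ext_inner_left ℝ fun e => ?_
  rw [inner_neg_right, ← integral_inner i1, ← integral_inner i2,
    setIntegral_eq_integral_of_forall_compl_eq_zero (fun x hx => by simp [hz' x hx]),
    setIntegral_eq_integral_of_forall_compl_eq_zero (fun x hx => by simp [hz x hx])]
  have j1 : Integrable (fun x => v x * fderiv ℝ ψ x e) := by
    refine (integrableOn_iff_integrable_of_support_subset fun x hx => ?_).1
      (i1.const_inner (𝕜 := ℝ) e |>.congr (Eventually.of_forall fun x => ?_))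
    · by_contra h
      exact hx (by simp [← inner_gradient_right, hz' x h])
    · simp [inner_smul_right]
  have j2 : Integrable (fun x => fderiv ℝ v x e * ψ x) := by
    refine (integrableOn_iff_integrable_of_support_subset fun x hx => ?_).1
      (i2.const_inner (𝕜 := ℝ) e |>.congr (Eventually.of_forall fun x => ?_))
    · by_contra h
      exact hx (by simp [hz x h])
    · simp [inner_smul_right, mul_comm]
  have j3 : Integrable (fun x => v x * ψ x) := by
    refine (integrableOn_iff_integrable_of_support_subset fun x hx => ?_).1 i3
    by_contra h
    exact hx (by simp [hz x h])
  have key := integral_mul_fderiv_eq_neg_fderiv_mul_of_integrable j2 j1 j3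
    (fun x hx => (hv.differentiableOn one_ne_zero).differentiableAt (hΩ.mem_nhds (hsupp hx)))
    (fun x _ => (hψ.differentiable one_ne_zero).differentiableAt)
  simpa [inner_smul_right, inner_gradient_right, mul_comm] using key

/-- A `C¹` function on `Ω` with integrable gradient has gradient measure `∇v` times Lebesgue
measure. -/
lemma isGradientMeasure_withDensityᵥ (hΩ : IsOpen Ω) (hv : ContDiffOn ℝ 1 v Ω)
    (hint : IntegrableOn v Ω) (hgrad : IntegrableOn (gradient v) Ω) :
    IsGradientMeasure Ω v ((volume.restrict Ω).withDensityᵥ (gradient v)) where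
  finite := variation_withDensityᵥ_univ_lt_top hgrad
  concentrated := by
    rw [Measure.variation_withDensityᵥ hgrad, withDensity_apply _ hΩ.measurableSet.compl,
      Measure.restrict_restrict hΩ.measurableSet.compl]
    simp
  integral_eq ψ hψ hcpt hsupp := by
    obtain ⟨C, hC⟩ := hψ.continuous.bounded_above_of_compact_support hcpt
    rw [integral_withDensityᵥ hgrad hψ.continuous.stronglyMeasurable hC]
    exact integral_smul_gradient_eq_neg hΩ hv hint hgrad (hψ.of_le (by simp)) hcpt hsupp

lemma variation_withDensityᵥ_gradient_univ (hgrad : IntegrableOn (gradient v) Ω) :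
    ((volume.restrict Ω).withDensityᵥ (gradient v)).variation Set.univ =
      ∫⁻ x in Ω, ‖gradient v x‖ₑ := by
  rw [Measure.variation_withDensityᵥ hgrad, withDensity_apply _ MeasurableSet.univ,
    Measure.restrict_univ]

end GradientMeasure

/-! ### Weak* convergence -/

section WeakStar

variable {m : ℕ} {Ω : Set (EuclideanSpace ℝ (Fin m))}

/-- Test functions are uniformly dense in `C₀(Ω)`. -/
lemma exists_testFunction_approx (f : C₀(EuclideanSpace ℝ (Fin m), ℝ)) (hf : ∀ x ∉ Ω, f x = 0)
    {ε : ℝ} (hε : 0 < ε) :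
    ∃ ψ : EuclideanSpace ℝ (Fin m) → ℝ, ContDiff ℝ ∞ ψ ∧ HasCompactSupport ψ ∧ tsupport ψ ⊆ Ω ∧
      ∀ x, |ψ x - f x| ≤ ε := by
  -- The soft thresholding of `f` at height `ε / 2` is compactly supported in `Ω`.
  let g : EuclideanSpace ℝ (Fin m) → ℝ := fun x => max (f x - ε / 2) 0 - max (-f x - ε / 2) 0
  have hfc : Continuous f := f.continuous
  have hg : Continuous g := by fun_prop
  have hgf : ∀ x, |g x - f x| ≤ ε / 2 := fun x => by
    change |max (f x - ε / 2) 0 - max (-f x - ε / 2) 0 - f x| ≤ ε / 2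
    generalize f x = t
    grind
  have hclosed : IsClosed {x | ε / 2 ≤ |f x|} := isClosed_le continuous_const hfc.abs
  have hcpt : IsCompact {x | ε / 2 ≤ |f x|} := by
    have h : ∀ᶠ x in cocompact _, |f x| < ε / 2 := by
      have := (zero_at_infty f).abs
      rw [abs_zero] at this
      exact this.eventually_lt_const (half_pos hε)
    obtain ⟨K, hK, hKf⟩ := mem_cocompact.1 h
    refine hK.of_isClosed_subset hclosed fun x hx => ?_
    by_contra hxK
    exact absurd (show |f x| < ε / 2 from hKf hxK) (not_lt.2 hx)
  have hsub : {x | ε / 2 ≤ |f x|} ⊆ Ω := fun x hx => by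
    by_contra h
    have hx : ε / 2 ≤ |f x| := hx
    rw [hf x h, abs_zero] at hx
    linarith
  have hgs : Function.support g ⊆ {x | ε / 2 ≤ |f x|} := fun x hx => by
    by_contra h
    have h : ¬ ε / 2 ≤ |f x| := h
    refine hx ?_
    change max (f x - ε / 2) 0 - max (-f x - ε / 2) 0 = 0
    revert h
    generalize f x = t
    grind
  obtain ⟨ψ, hψ, hψg, hψs⟩ := hg.exists_contDiff_approx (ε := fun _ => ε / 2) ⊤
    continuous_const (fun _ => half_pos hε)
  have hts : tsupport ψ ⊆ {x | ε / 2 ≤ |f x|} := closure_minimal (hψs.trans hgs) hclosed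
  refine ⟨ψ, hψ, hcpt.of_isClosed_subset (isClosed_tsupport ψ) hts, hts.trans hsub, fun x => ?_⟩
  have h1 := hψg x
  rw [Real.dist_eq] at h1
  calc |ψ x - f x| ≤ |ψ x - g x| + |g x - f x| := abs_sub_le _ _ _
    _ ≤ ε := by linarith [hgf x]

/-- Convergence in `L¹(Ω)` with bounded total variations implies weak* convergence of the
gradient measures: it can be checked on test functions, and there it is an integration by parts. -/
lemma tendsto_integral_gradientMeasure {v : ℕ → EuclideanSpace ℝ (Fin m) → ℝ}
    {u : EuclideanSpace ℝ (Fin m) → ℝ}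
    {ν : ℕ → VectorMeasure (EuclideanSpace ℝ (Fin m)) (EuclideanSpace ℝ (Fin m))}
    {μ : VectorMeasure (EuclideanSpace ℝ (Fin m)) (EuclideanSpace ℝ (Fin m))}
    (hv : ∀ i, IntegrableOn (v i) Ω) (hu : IntegrableOn u Ω)
    (hvu : Tendsto (fun i => ∫⁻ x in Ω, ‖v i x - u x‖ₑ) atTop (𝓝 0))
    (hν : ∀ i, IsGradientMeasure Ω (v i) (ν i)) (hμ : IsGradientMeasure Ω u μ)
    {C : ℝ≥0∞} (hC : C ≠ ⊤) (hνC : ∀ i, (ν i).variation Set.univ ≤ C)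
    (f : C₀(EuclideanSpace ℝ (Fin m), ℝ)) (hf : ∀ x ∉ Ω, f x = 0) :
    Tendsto (fun i => ∫ᵛ x, f x ∂•(ν i)) atTop (𝓝 (∫ᵛ x, f x ∂•μ)) := by
  set D : ℝ := (C + μ.variation Set.univ).toReal with hD
  have hD0 : 0 ≤ D := ENNReal.toReal_nonneg
  have hfin : ∀ i, IsFiniteMeasure (ν i).variation := fun i => ⟨(hν i).finite⟩
  have hfin' : IsFiniteMeasure μ.variation := ⟨hμ.finite⟩
  have hint : ∀ ρ : VectorMeasure (EuclideanSpace ℝ (Fin m)) (EuclideanSpace ℝ (Fin m)),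
      IsFiniteMeasure ρ.variation → Integrable f ρ.variation := fun ρ _ =>
    Integrable.of_bound f.continuous.aestronglyMeasurable ‖f.toBCF‖
      (Eventually.of_forall fun x => f.toBCF.norm_coe_le_norm x)
  have happrox : ∀ (ρ : VectorMeasure (EuclideanSpace ℝ (Fin m)) (EuclideanSpace ℝ (Fin m)))
      (ψ : EuclideanSpace ℝ (Fin m) → ℝ) (δ : ℝ), IsFiniteMeasure ρ.variation →
      ContDiff ℝ ∞ ψ → HasCompactSupport ψ →
      (∀ x, |ψ x - f x| ≤ δ) → 0 ≤ δ → ρ.variation Set.univ ≤ C + μ.variation Set.univ →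
      ‖∫ᵛ x, f x ∂•ρ - ∫ᵛ x, ψ x ∂•ρ‖ ≤ δ * D := by
    intro ρ ψ δ hρ hψ hψc hδ hδ0 hle
    obtain ⟨B, hB⟩ := hψ.continuous.bounded_above_of_compact_support hψc
    rw [← VectorMeasure.integral_fun_sub (hint ρ hρ) (Integrable.of_bound
      hψ.continuous.aestronglyMeasurable B (Eventually.of_forall hB))]
    have h1 := enorm_vectorMeasure_integral_le ρ (fun x => f x - ψ x)
    have h2 : ∫⁻ x, ‖f x - ψ x‖ₑ ∂ρ.variation ≤ ENNReal.ofReal (δ * D) := by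
      calc ∫⁻ x, ‖f x - ψ x‖ₑ ∂ρ.variation ≤ ∫⁻ _, ENNReal.ofReal δ ∂ρ.variation := by
            refine lintegral_mono fun x => ?_
            rw [← ofReal_norm, Real.norm_eq_abs, abs_sub_comm]
            exact ENNReal.ofReal_le_ofReal (hδ x)
        _ = ENNReal.ofReal δ * ρ.variation Set.univ := lintegral_const _
        _ ≤ ENNReal.ofReal δ * ENNReal.ofReal D := by
            rw [hD, ENNReal.ofReal_toReal (by finiteness)]
            gcongr
        _ = _ := (ENNReal.ofReal_mul hδ0).symm
    have h3 := h1.trans h2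
    rw [← ofReal_norm] at h3
    exact (ENNReal.ofReal_le_ofReal_iff (by positivity)).1 h3
  rw [Metric.tendsto_nhds]
  intro ε hε
  obtain ⟨ψ, hψ, hψc, hψs, hψf⟩ := exists_testFunction_approx f hf
    (ε := ε / (4 * (D + 1))) (by positivity)
  have hsmall : ε / (4 * (D + 1)) * D ≤ ε / 4 := by
    rw [div_mul_eq_mul_div, div_le_div_iff₀ (by positivity) (by positivity)]
    nlinarith
  have hψ1 : ContDiff ℝ 1 ψ := hψ.of_le (by simp)
  obtain ⟨B, hB⟩ := (continuous_gradient hψ1).bounded_above_of_compact_support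
    (hasCompactSupport_gradient hψc)
  have hB0 : 0 ≤ B := (norm_nonneg _).trans (hB 0)
  have hsmul : ∀ w : EuclideanSpace ℝ (Fin m) → ℝ, IntegrableOn w Ω →
      IntegrableOn (fun x => w x • gradient ψ x) Ω := fun w hw =>
    hw.smul_bdd B (continuous_gradient hψ1).aestronglyMeasurable.restrict
      (Eventually.of_forall hB)
  have htest : Tendsto (fun i => ‖∫ᵛ x, ψ x ∂•(ν i) - ∫ᵛ x, ψ x ∂•μ‖ₑ) atTop (𝓝 0) := by
    have hlim : Tendsto (fun i => ENNReal.ofReal B * ∫⁻ x in Ω, ‖v i x - u x‖ₑ) atTop (𝓝 0) := by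
      simpa using ENNReal.Tendsto.const_mul hvu (Or.inr ENNReal.ofReal_ne_top)
    refine tendsto_of_tendsto_of_tendsto_of_le_of_le tendsto_const_nhds hlim
      (fun _ => zero_le) fun i => ?_
    have h1 := (hν i).integral_eq ψ hψ hψc hψs
    have h2 := hμ.integral_eq ψ hψ hψc hψs
    have h3 : ∫ᵛ x, ψ x ∂•(ν i) - ∫ᵛ x, ψ x ∂•μ =
        ∫ x in Ω, (u x • gradient ψ x - v i x • gradient ψ x) := by
      rw [integral_sub (hsmul u hu) (hsmul _ (hv i)), h1, h2]
      abel
    calc ‖∫ᵛ x, ψ x ∂•(ν i) - ∫ᵛ x, ψ x ∂•μ‖ₑ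
        ≤ ∫⁻ x in Ω, ‖u x • gradient ψ x - v i x • gradient ψ x‖ₑ := by
          rw [h3]; exact enorm_integral_le_lintegral_enorm _
      _ ≤ ∫⁻ x in Ω, ENNReal.ofReal B * ‖v i x - u x‖ₑ := by
          refine lintegral_mono fun x => ?_
          rw [← sub_smul, enorm_smul, mul_comm, enorm_sub_rev]
          gcongr
          rw [← ofReal_norm]
          exact ENNReal.ofReal_le_ofReal (hB x)
      _ = _ := lintegral_const_mul' _ _ ENNReal.ofReal_ne_top
  filter_upwards [htest.eventually_lt_const (ENNReal.ofReal_pos.2 (half_pos hε))] with i hi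
  rw [← ofReal_norm, ENNReal.ofReal_lt_ofReal_iff (half_pos hε)] at hi
  have e1 := happrox (ν i) ψ _ (hfin i) hψ hψc hψf (by positivity)
    ((hνC i).trans le_self_add)
  have e2 := happrox μ ψ _ hfin' hψ hψc hψf (by positivity) le_add_self
  rw [dist_eq_norm]
  have : ∫ᵛ x, f x ∂•(ν i) - ∫ᵛ x, f x ∂•μ =
      (∫ᵛ x, f x ∂•(ν i) - ∫ᵛ x, ψ x ∂•(ν i)) + (∫ᵛ x, ψ x ∂•(ν i) - ∫ᵛ x, ψ x ∂•μ)
        - (∫ᵛ x, f x ∂•μ - ∫ᵛ x, ψ x ∂•μ) := by abel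
  rw [this]
  refine (norm_sub_le _ _).trans_lt ?_
  have := norm_add_le (∫ᵛ x, f x ∂•(ν i) - ∫ᵛ x, ψ x ∂•(ν i))
    (∫ᵛ x, ψ x ∂•(ν i) - ∫ᵛ x, ψ x ∂•μ)
  linarith

end WeakStar

/-! ### Mollification -/

open scoped Convolution

section Mollify

variable {E F : Type*} [NormedAddCommGroup E] [InnerProductSpace ℝ E] [FiniteDimensional ℝ E]
  [MeasurableSpace E] [BorelSpace E] [NormedAddCommGroup F] [NormedSpace ℝ F]

/-- The mollification of `f` by the normalized bump function `φ`. -/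
noncomputable def mollify (φ : ContDiffBump (0 : E)) (f : E → F) : E → F :=
  φ.normed volume ⋆[ContinuousLinearMap.lsmul ℝ ℝ, volume] f

lemma mollify_apply (φ : ContDiffBump (0 : E)) (f : E → F) (x : E) :
    mollify φ f x = ∫ y, φ.normed volume (x - y) • f y := by
  simp [mollify, convolution_eq_swap]

lemma lintegral_enorm_normed_sub (φ : ContDiffBump (0 : E)) (y : E) :
    ∫⁻ x, ‖φ.normed volume (x - y)‖ₑ = 1 := by
  rw [lintegral_sub_right_eq_self (μ := volume) (fun x => ‖φ.normed volume x‖ₑ) y]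
  have h : ∀ x, ‖φ.normed volume x‖ₑ = ENNReal.ofReal (φ.normed volume x) := fun x =>
    Real.enorm_of_nonneg (φ.nonneg_normed x)
  simp_rw [h]
  rw [← ofReal_integral_eq_lintegral_ofReal φ.integrable_normed
    (Eventually.of_forall φ.nonneg_normed), φ.integral_normed, ENNReal.ofReal_one]

/-- Integrating out the mollified variable, for functions against an arbitrary measure; this bounds
mollifications of functions and of measures alike. -/
lemma lintegral_lintegral_mollifier (φ : ContDiffBump (0 : E)) {κ : Measure E} [SFinite κ]
    {g : E → ℝ≥0∞} (hg : AEMeasurable g κ) :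
    ∫⁻ x, ∫⁻ y, ‖φ.normed volume (x - y)‖ₑ * g y ∂κ = ∫⁻ y, g y ∂κ := by
  have hmeas : AEMeasurable (fun p : E × E => ‖φ.normed volume (p.1 - p.2)‖ₑ * g p.2)
      (volume.prod κ) := by
    refine AEMeasurable.mul ?_ hg.comp_snd
    exact (φ.continuous_normed.comp
      (continuous_fst.sub continuous_snd)).enorm.measurable.aemeasurable
  rw [lintegral_lintegral_swap hmeas]
  refine lintegral_congr fun y => ?_
  have hm : Measurable fun x => ‖φ.normed volume (x - y)‖ₑ :=
    (φ.continuous_normed.comp (continuous_id.sub continuous_const)).enorm.measurable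
  rw [lintegral_mul_const'' _ hm.aemeasurable]
  simp [lintegral_enorm_normed_sub]

lemma lintegral_enorm_mollify_le (φ : ContDiffBump (0 : E)) {f : E → F} (hf : Integrable f) :
    ∫⁻ x, ‖mollify φ f x‖ₑ ≤ ∫⁻ x, ‖f x‖ₑ := by
  rw [← lintegral_lintegral_mollifier φ hf.1.enorm]
  refine lintegral_mono fun x => ?_
  rw [mollify_apply]
  refine (enorm_integral_le_lintegral_enorm _).trans_eq ?_
  simp [enorm_smul]

lemma integrable_mollifier_smul (φ : ContDiffBump (0 : E)) {f : E → F} (hf : Integrable f)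
    (x : E) : Integrable fun y => φ.normed volume (x - y) • f y := by
  obtain ⟨C, hC⟩ := φ.continuous_normed (μ := volume).bounded_above_of_compact_support
    φ.hasCompactSupport_normed
  exact hf.bdd_smul C (φ.continuous_normed.comp
    (continuous_const.sub continuous_id)).aestronglyMeasurable
    (Eventually.of_forall fun y => hC (x - y))

lemma mollify_sub (φ : ContDiffBump (0 : E)) {f g : E → F} (hf : Integrable f)
    (hg : Integrable g) (x : E) :
    mollify φ (fun y => f y - g y) x = mollify φ f x - mollify φ g x := by
  simp only [mollify_apply, smul_sub]
  exact integral_sub (integrable_mollifier_smul φ hf x) (integrable_mollifier_smul φ hg x)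

lemma mollify_eq_zero (φ : ContDiffBump (0 : E)) {f : E → F} {x : E}
    (hx : ∀ y ∈ Metric.ball x φ.rOut, f y = 0) : mollify φ f x = 0 := by
  rw [mollify_apply]
  refine integral_eq_zero_of_ae (Eventually.of_forall fun y => ?_)
  by_cases hy : y ∈ Metric.ball x φ.rOut
  · simp [hx y hy]
  · have : x - y ∉ Function.support (φ.normed volume) := by
      rw [φ.support_normed_eq]
      simpa [dist_eq_norm, norm_sub_rev] using hy
    simp [Function.notMem_support.1 this]

lemma integrable_mollify (φ : ContDiffBump (0 : E)) {f : E → F} (hf : Integrable f) :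
    Integrable (mollify φ f) :=
  φ.integrable_normed.integrable_convolution _ hf

lemma contDiff_mollify [CompleteSpace F] (φ : ContDiffBump (0 : E)) {f : E → F}
    (hf : Integrable f) : ContDiff ℝ ∞ (mollify φ f) :=
  φ.hasCompactSupport_normed.contDiff_convolution_left _ φ.contDiff_normed hf.locallyIntegrable

variable [CompleteSpace F]

/-- Mollifications with sufficiently small radius are close in `L¹`. -/
lemma exists_lintegral_mollify_sub_le {f : E → F} (hf : Integrable f) {ε : ℝ≥0∞} (hε : ε ≠ 0) :
    ∃ δ > 0, ∀ φ : ContDiffBump (0 : E), φ.rOut < δ →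
      ∫⁻ x, ‖mollify φ f x - f x‖ₑ ≤ ε := by
  have hε3 : ε / 3 ≠ 0 := by simp [hε]
  obtain ⟨g, hgc, hfg, hg, hgi⟩ := hf.exists_hasCompactSupport_lintegral_sub_le hε3
  set K := Metric.cthickening 1 (tsupport g) with hK
  have hKc : IsCompact K := hgc.isCompact.cthickening
  obtain ⟨η, hη, hηK⟩ : ∃ η : ℝ, 0 < η ∧ ENNReal.ofReal η * volume K ≤ ε / 3 := by
    obtain ⟨η, hη, h⟩ := ENNReal.exists_nnreal_pos_mul_lt
      (hKc.measure_lt_top (μ := volume)).ne hε3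
    exact ⟨η, by exact_mod_cast hη, by simpa using h.le⟩
  obtain ⟨δ, hδ, hδg⟩ := Metric.uniformContinuous_iff.1
    (hgc.uniformContinuous_of_continuous hg) η hη
  refine ⟨min δ 1, by positivity, fun φ hφ => ?_⟩
  have hmg : ∫⁻ x, ‖mollify φ g x - g x‖ₑ ≤ ε / 3 := by
    refine le_trans ?_ hηK
    rw [← lintegral_indicator_const hKc.measurableSet]
    refine lintegral_mono fun x => ?_
    by_cases hx : x ∈ K
    · rw [Set.indicator_of_mem hx, ← ofReal_norm, ← dist_eq_norm]
      refine ENNReal.ofReal_le_ofReal (φ.dist_normed_convolution_le hg.aestronglyMeasurable ?_)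
      exact fun y hy => (hδg ((Metric.mem_ball.1 hy).trans
        (hφ.trans_le (min_le_left _ _)))).le
    · have hz : ∀ y ∈ Metric.ball x φ.rOut, g y = 0 := fun y hy => by
        by_contra h
        refine hx (Metric.mem_cthickening_of_dist_le x y 1 _ (subset_tsupport _ h) ?_)
        rw [dist_comm]
        exact (Metric.mem_ball.1 hy).le.trans (hφ.le.trans (min_le_right _ _))
      rw [mollify_eq_zero φ hz, hz x (Metric.mem_ball_self φ.rOut_pos)]
      simp
  have hmfg : ∫⁻ x, ‖mollify φ f x - mollify φ g x‖ₑ ≤ ε / 3 := by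
    simp_rw [← mollify_sub φ hf hgi]
    exact (lintegral_enorm_mollify_le φ (hf.sub hgi)).trans hfg
  calc ∫⁻ x, ‖mollify φ f x - f x‖ₑ
      ≤ ∫⁻ x, (‖mollify φ f x - mollify φ g x‖ₑ + ‖mollify φ g x - g x‖ₑ + ‖f x - g x‖ₑ) := by
        refine lintegral_mono fun x => ?_
        have : mollify φ f x - f x = (mollify φ f x - mollify φ g x) +
          (mollify φ g x - g x) - (f x - g x) := by abel
        rw [this]
        exact enorm_sub_le.trans (by gcongr; exact enorm_add_le _ _)
    _ = (∫⁻ x, ‖mollify φ f x - mollify φ g x‖ₑ) + (∫⁻ x, ‖mollify φ g x - g x‖ₑ) +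
          ∫⁻ x, ‖f x - g x‖ₑ := by
        have m1 : AEMeasurable fun x => ‖f x - g x‖ₑ := (hf.sub hgi).1.enorm
        have m2 : AEMeasurable fun x => ‖mollify φ g x - g x‖ₑ :=
          ((integrable_mollify φ hgi).sub hgi).1.enorm
        rw [lintegral_add_right' _ m1, lintegral_add_right' _ m2]
    _ ≤ ε / 3 + ε / 3 + ε / 3 := add_le_add (add_le_add hmfg hmg) hfg
    _ = ε := ENNReal.add_thirds ε

end Mollify

section MollifyGradient

variable {m : ℕ} {Ω : Set (EuclideanSpace ℝ (Fin m))} {u ζ : EuclideanSpace ℝ (Fin m) → ℝ}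
  {μ : VectorMeasure (EuclideanSpace ℝ (Fin m)) (EuclideanSpace ℝ (Fin m))}

lemma integrable_smul_of_support_subset {F : Type*} [NormedAddCommGroup F] [NormedSpace ℝ F]
    {h : EuclideanSpace ℝ (Fin m) → F} (hu : IntegrableOn u Ω) (hh : Continuous h)
    (hcpt : HasCompactSupport h) (hsupp : ∀ x ∉ Ω, h x = 0) :
    Integrable fun y => u y • h y := by
  obtain ⟨C, hC⟩ := hh.bounded_above_of_compact_support hcpt
  refine (integrableOn_iff_integrable_of_support_subset (s := Ω) fun x hx => ?_).1
    (hu.smul_bdd C hh.aestronglyMeasurable.restrict (Eventually.of_forall hC))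
  by_contra h'
  exact hx (by simp [hsupp x h'])

/-- The gradient of the mollification of `u ζ`, where `ζ` is a test function on `Ω`: the product
rule, and integration by parts against the gradient measure of `u`. -/
lemma gradient_mollify_smul (hu : IntegrableOn u Ω) (hμ : IsGradientMeasure Ω u μ)
    (hζ : ContDiff ℝ ∞ ζ) (hcpt : HasCompactSupport ζ) (hsupp : tsupport ζ ⊆ Ω)
    (φ : ContDiffBump (0 : EuclideanSpace ℝ (Fin m))) (x : EuclideanSpace ℝ (Fin m)) :
    gradient (mollify φ fun y => u y * ζ y) x =
      ∫ᵛ y, φ.normed volume (x - y) * ζ y ∂•μ + mollify φ (fun y => u y • gradient ζ y) x := by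
  have hζ1 : ContDiff ℝ 1 ζ := hζ.of_le (by simp)
  have hφ : ContDiff ℝ ∞ (φ.normed volume) := φ.contDiff_normed
  have hφ1 : ContDiff ℝ 1 (φ.normed volume) := φ.contDiff_normed
  have hz : ∀ y ∉ Ω, ζ y = 0 := fun y hy => image_eq_zero_of_notMem_tsupport fun h => hy (hsupp h)
  have hz' : ∀ y ∉ Ω, gradient ζ y = 0 := fun y hy =>
    gradient_eq_zero_of_notMem_tsupport fun h => hy (hsupp h)
  have hf : Integrable fun y => u y * ζ y :=
    integrable_smul_of_support_subset hu hζ.continuous hcpt hz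
  have hf' : Integrable fun y => u y • gradient ζ y :=
    integrable_smul_of_support_subset hu (continuous_gradient hζ1)
      (hasCompactSupport_gradient hcpt) hz'
  set ψ : EuclideanSpace ℝ (Fin m) → ℝ := fun y => φ.normed volume (x - y) * ζ y with hψ
  have hψs : ContDiff ℝ ∞ ψ := (hφ.comp (contDiff_const.sub contDiff_id)).mul hζ
  have hψc : HasCompactSupport ψ := hcpt.mul_left
  have hψt : tsupport ψ ⊆ Ω := (tsupport_mul_subset_right).trans hsupp
  have hgrad : ∀ y, gradient ψ y =
      φ.normed volume (x - y) • gradient ζ y - ζ y • gradient (φ.normed volume) (x - y) := by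
    intro y
    have d1 : HasFDerivAt (fun y => φ.normed volume (x - y))
        ((fderiv ℝ (φ.normed volume) (x - y)).comp
          (-ContinuousLinearMap.id ℝ (EuclideanSpace ℝ (Fin m)))) y :=
      ((hφ1.differentiable one_ne_zero).differentiableAt.hasFDerivAt).comp y
        ((hasFDerivAt_id y).const_sub x)
    have d2 : HasFDerivAt ψ _ y := d1.mul ((hζ1.differentiable one_ne_zero) y).hasFDerivAt
    refine ext_inner_left ℝ fun e => ?_
    rw [inner_gradient_right, inner_sub_right, inner_smul_right, inner_smul_right,
      inner_gradient_right, inner_gradient_right, d2.fderiv]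
    simp [sub_eq_add_neg]
  have hparts := hμ.integral_eq ψ hψs hψc hψt
  have hD : gradient (mollify φ fun y => u y * ζ y) x =
      ∫ y, (u y * ζ y) • gradient (φ.normed volume) (x - y) := by
    obtain ⟨C, hC⟩ := (continuous_gradient hφ1).bounded_above_of_compact_support
      (hasCompactSupport_gradient φ.hasCompactSupport_normed)
    have hint : Integrable fun y => (u y * ζ y) • gradient (φ.normed volume) (x - y) :=
      hf.smul_bdd C ((continuous_gradient hφ1).comp
        (continuous_const.sub continuous_id)).aestronglyMeasurable
        (Eventually.of_forall fun y => hC (x - y))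
    have h := φ.hasCompactSupport_normed.hasFDerivAt_convolution_left (μ := volume)
      (ContinuousLinearMap.lsmul ℝ ℝ) hφ1 hf.locallyIntegrable x
    rw [gradient, mollify, h.fderiv, convolution_eq_swap, LinearIsometryEquiv.symm_apply_eq,
      ← LinearIsometryEquiv.coe_toContinuousLinearEquiv,
      ← ContinuousLinearEquiv.integral_comp_comm]
    refine integral_congr_ae (Eventually.of_forall fun y => ?_)
    ext e
    simp [mul_comm]
  have hset : ∫ y in Ω, u y • gradient ψ y = ∫ y, u y • gradient ψ y :=
    setIntegral_eq_integral_of_forall_compl_eq_zero fun y hy => by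
      rw [gradient_eq_zero_of_notMem_tsupport fun h => hy (hψt h), smul_zero]
  have hsplit : ∫ y, (u y * ζ y) • gradient (φ.normed volume) (x - y) =
      mollify φ (fun y => u y • gradient ζ y) x - ∫ y, u y • gradient ψ y := by
    rw [mollify_apply, ← integral_sub (integrable_mollifier_smul φ hf' x)
      (integrable_smul_of_support_subset hu (continuous_gradient (hψs.of_le (by simp)))
        (hasCompactSupport_gradient hψc)
        fun y hy => gradient_eq_zero_of_notMem_tsupport fun h => hy (hψt h))]
    refine integral_congr_ae (Eventually.of_forall fun y => ?_)
    simp only [hgrad, smul_sub, smul_smul]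
    rw [mul_comm (u y) (φ.normed volume (x - y))]
    abel
  rw [hD, hsplit, ← hset, hparts]
  abel

/-- The mollification of the measure `ζ μ` has `L¹` norm at most the total variation of `ζ μ`. -/
lemma lintegral_enorm_integral_mollifier_le [IsFiniteMeasure μ.variation] (hζ : Continuous ζ)
    (φ : ContDiffBump (0 : EuclideanSpace ℝ (Fin m))) :
    ∫⁻ x, ‖∫ᵛ y, φ.normed volume (x - y) * ζ y ∂•μ‖ₑ ≤ ∫⁻ y, ‖ζ y‖ₑ ∂μ.variation := by
  rw [← lintegral_lintegral_mollifier φ hζ.enorm.measurable.aemeasurable]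
  refine lintegral_mono fun x => (enorm_vectorMeasure_integral_le μ _).trans_eq ?_
  simp [enorm_mul]

end MollifyGradient

/-! ### Meyers–Serrin approximation -/

section Partition

variable {E : Type*} [NormedAddCommGroup E] [NormedSpace ℝ E] [FiniteDimensional ℝ E]

lemma exists_compact_exhaustion {Ω : Set E} (hΩ : IsOpen Ω) :
    ∃ K : ℕ → Set E, (∀ n, IsCompact (K n)) ∧ (∀ n, K n ⊆ interior (K (n + 1))) ∧
      (∀ n, K n ⊆ Ω) ∧ Ω ⊆ ⋃ n, interior (K n) := by
  have : LocallyCompactSpace Ω := hΩ.locallyCompactSpace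
  let L : CompactExhaustion Ω := CompactExhaustion.choice Ω
  have hsub : ∀ n, Subtype.val '' L n ⊆ interior (Subtype.val '' L (n + 1)) := fun n =>
    (Set.image_mono (L.subset_interior_succ n)).trans
      (hΩ.isOpenMap_subtype_val.image_interior_subset _)
  refine ⟨fun n => Subtype.val '' L n, fun n => (L.isCompact n).image continuous_subtype_val,
    hsub, fun n => by simp, fun x hx => ?_⟩
  obtain ⟨n, hn⟩ := L.exists_mem ⟨x, hx⟩
  exact Set.mem_iUnion.2 ⟨n + 1, hsub n ⟨_, hn, rfl⟩⟩

/-- A smooth partition of unity of an open set `Ω` by test functions `ζ n`, obtained as successive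
differences of cutoff functions. Only `ζ 0, …, ζ (N + 1)` are non-zero on the `N`-th member `U N`
of an open cover of `Ω`, even after enlarging the support of each `ζ n` by `ρ n`. -/
lemma exists_partition_of_unity {Ω : Set E} (hΩ : IsOpen Ω) :
    ∃ (U : ℕ → Set E) (ρ : ℕ → ℝ) (ζ : ℕ → E → ℝ), (∀ n, IsOpen (U n)) ∧ (Ω ⊆ ⋃ n, U n) ∧
      (∀ n, 0 < ρ n) ∧ (∀ n, ContDiff ℝ ∞ (ζ n)) ∧ (∀ n, HasCompactSupport (ζ n)) ∧
      (∀ n, tsupport (ζ n) ⊆ Ω) ∧ (∀ n x, 0 ≤ ζ n x) ∧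
      (∀ N, ∀ x ∈ U N, ∑ i ∈ Finset.range (N + 2), ζ i x = 1) ∧
      ∀ N n, N + 2 ≤ n → ∀ x ∈ U N, ∀ y ∈ Metric.ball x (ρ n), ζ n y = 0 := by
  obtain ⟨K, hKc, hKs, hKΩ, hK⟩ := exists_compact_exhaustion hΩ
  have hmono : Monotone K := monotone_nat_of_le_succ fun n => (hKs n).trans interior_subset
  have hc : ∀ n, ∃ c : E → ℝ, ContDiff ℝ ∞ c ∧ (∀ x ∈ K n, c x = 1) ∧
      (∀ x ∉ K (n + 1), c x = 0) ∧ ∀ x, c x ∈ Set.Icc 0 1 := fun n => by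
    obtain ⟨c, h1, h0, hI⟩ := exists_contMDiffMap_one_nhds_of_subset_interior (n := ⊤)
      (modelWithCornersSelf ℝ E) (hKc n).isClosed (hKs n)
    exact ⟨c, c.contMDiff.contDiff, fun x hx => h1.self_of_nhdsSet x hx, h0, hI⟩
  choose c hcs hc1 hc0 hcI using hc
  have hρ : ∀ n, ∃ δ : ℝ, 0 < δ ∧ Metric.cthickening δ (K n) ⊆ interior (K (n + 1)) := fun n =>
    (hKc n).exists_cthickening_subset_open isOpen_interior (hKs n)
  choose ρ hρ0 hρK using hρ
  -- The partial sums telescope to the cutoff functions.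
  let ζ : ℕ → E → ℝ := fun n => Nat.rec (c 0) (fun k _ x => c (k + 1) x - c k x) n
  have hζ0 : ∀ n, ∀ x ∉ K (n + 1), ζ n x = 0 := by
    rintro (_ | n) x hx
    · exact hc0 0 x hx
    · change c (n + 1) x - c n x = 0
      rw [hc0 (n + 1) x hx, hc0 n x fun h => hx (hmono (by omega) h), sub_zero]
  have hsum : ∀ n x, ∑ i ∈ Finset.range (n + 1), ζ i x = c n x := by
    intro n x
    induction n with
    | zero => simp [ζ]
    | succ n ih =>
      rw [Finset.sum_range_succ, ih]
      change c n x + (c (n + 1) x - c n x) = _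
      ring
  have hts : ∀ n, tsupport (ζ n) ⊆ K (n + 1) := fun n =>
    closure_minimal (fun x hx => by
      by_contra h
      exact hx (hζ0 n x h)) (hKc _).isClosed
  refine ⟨fun n => interior (K n), fun n => ρ (n - 2), ζ, fun n => isOpen_interior, hK,
    fun n => hρ0 _, ?_, fun n => (hKc _).of_isClosed_subset (isClosed_tsupport _) (hts n),
    fun n => (hts n).trans (hKΩ _), ?_, ?_, ?_⟩
  · rintro (_ | n)
    · exact hcs 0
    · exact (hcs (n + 1)).sub (hcs n)
  · rintro (_ | n) x
    · exact (hcI 0 x).1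
    · change 0 ≤ c (n + 1) x - c n x
      by_cases hx : x ∈ K (n + 1)
      · rw [hc1 _ x hx]
        linarith [(hcI n x).2]
      · rw [hc0 n x hx, sub_zero]
        exact (hcI _ x).1
  · intro N x hx
    rw [hsum (N + 1) x]
    exact hc1 _ x (hmono (by omega) (interior_subset hx))
  · intro N n hn x hx y hy
    obtain ⟨k, rfl⟩ : ∃ k, n = k + 2 := ⟨n - 2, by omega⟩
    have hxk : x ∈ K k := hmono (by omega) (interior_subset hx)
    have hyk : y ∈ K (k + 1) := interior_subset (hρK k
      (Metric.mem_cthickening_of_dist_le y x _ _ hxk (Metric.mem_ball.1 hy).le))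
    change c (k + 1 + 1) y - c (k + 1) y = 0
    rw [hc1 _ y hyk, hc1 _ y (hmono (by omega) hyk), sub_self]

end Partition

section MeyersSerrin

variable {m : ℕ} {Ω : Set (EuclideanSpace ℝ (Fin m))} {u : EuclideanSpace ℝ (Fin m) → ℝ}
  {μ : VectorMeasure (EuclideanSpace ℝ (Fin m)) (EuclideanSpace ℝ (Fin m))}

lemma gradient_finset_sum {ι : Type*} (s : Finset ι)
    {f : ι → EuclideanSpace ℝ (Fin m) → ℝ} {x : EuclideanSpace ℝ (Fin m)}
    (hf : ∀ i ∈ s, DifferentiableAt ℝ (f i) x) :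
    gradient (fun y => ∑ i ∈ s, f i y) x = ∑ i ∈ s, gradient (f i) x := by
  simp only [gradient]
  rw [fderiv_fun_sum hf, map_sum]

/-- **Meyers–Serrin approximation** in `BV(Ω)`: `u` is approximated in `L¹(Ω)` by `C¹` functions
whose total variations are almost bounded by that of `u`. -/
theorem exists_contDiffOn_approx (hΩ : IsOpen Ω) (hu : IntegrableOn u Ω)
    (hμ : IsGradientMeasure Ω u μ) {ε : ℝ≥0∞} (hε : ε ≠ 0) :
    ∃ v : EuclideanSpace ℝ (Fin m) → ℝ, ContDiffOn ℝ 1 v Ω ∧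
      ∫⁻ x in Ω, ‖v x - u x‖ₑ ≤ ε ∧
      ∫⁻ x in Ω, ‖gradient v x‖ₑ ≤ μ.variation Set.univ + ε := by
  have hfin : IsFiniteMeasure μ.variation := ⟨hμ.finite⟩
  obtain ⟨U, ρ, ζ, hU, hUΩ, hρ, hζ, hζc, hζt, hζ0, hζ1, hζz⟩ := exists_partition_of_unity hΩ
  obtain ⟨η, hη0, hη⟩ := ENNReal.exists_pos_sum_of_countable hε ℕ
  have hζ' : ∀ n, ContDiff ℝ 1 (ζ n) := fun n => (hζ n).of_le (by simp)
  have hz : ∀ n, ∀ x ∉ Ω, ζ n x = 0 := fun n x hx =>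
    image_eq_zero_of_notMem_tsupport fun h => hx (hζt n h)
  have hf : ∀ n, Integrable fun x => u x * ζ n x := fun n =>
    integrable_smul_of_support_subset hu (hζ n).continuous (hζc n) (hz n)
  have hg : ∀ n, Integrable fun x => u x • gradient (ζ n) x := fun n =>
    integrable_smul_of_support_subset hu (continuous_gradient (hζ' n))
      (hasCompactSupport_gradient (hζc n)) fun x hx =>
        gradient_eq_zero_of_notMem_tsupport fun h => hx (hζt n h)
  have hφ : ∀ n, ∃ φ : ContDiffBump (0 : EuclideanSpace ℝ (Fin m)), φ.rOut < ρ n ∧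
      ∫⁻ x, ‖mollify φ (fun x => u x * ζ n x) x - u x * ζ n x‖ₑ ≤ η n ∧
      ∫⁻ x, ‖mollify φ (fun x => u x • gradient (ζ n) x) x - u x • gradient (ζ n) x‖ₑ ≤ η n := by
    intro n
    have hηn : (η n : ℝ≥0∞) ≠ 0 := by exact_mod_cast (hη0 n).ne'
    obtain ⟨δ₁, h₁, H₁⟩ := exists_lintegral_mollify_sub_le (hf n) hηn
    obtain ⟨δ₂, h₂, H₂⟩ := exists_lintegral_mollify_sub_le (hg n) hηn
    have hr : 0 < min (ρ n) (min δ₁ δ₂) := lt_min (hρ n) (lt_min h₁ h₂)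
    let φ : ContDiffBump (0 : EuclideanSpace ℝ (Fin m)) :=
      ⟨min (ρ n) (min δ₁ δ₂) / 3, min (ρ n) (min δ₁ δ₂) / 2, by positivity, by linarith⟩
    have hφ : φ.rOut < min (ρ n) (min δ₁ δ₂) := half_lt_self hr
    exact ⟨φ, hφ.trans_le (min_le_left _ _),
      H₁ φ (hφ.trans_le ((min_le_right _ _).trans (min_le_left _ _))),
      H₂ φ (hφ.trans_le ((min_le_right _ _).trans (min_le_right _ _)))⟩
  choose φ hφρ hφ1 hφ2 using hφ
  -- The `n`-th mollified piece has gradient `A n + B n`: `A n` mollifies the measure `ζ n • Du` and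
  -- `B n` mollifies `u ∇ζ n`. The sum of the `u ∇ζ n` vanishes: the `B n` only contribute errors.
  let w : ℕ → EuclideanSpace ℝ (Fin m) → ℝ := fun n => mollify (φ n) fun x => u x * ζ n x
  let A : ℕ → EuclideanSpace ℝ (Fin m) → EuclideanSpace ℝ (Fin m) := fun n x =>
    ∫ᵛ y, (φ n).normed volume (x - y) * ζ n y ∂•μ
  let B : ℕ → EuclideanSpace ℝ (Fin m) → EuclideanSpace ℝ (Fin m) := fun n =>
    mollify (φ n) fun x => u x • gradient (ζ n) x
  have hw : ∀ n, ContDiff ℝ 1 (w n) := fun n => (contDiff_mollify (φ n) (hf n)).of_le (by simp)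
  have hwgrad : ∀ n x, gradient (w n) x = A n x + B n x := fun n x =>
    gradient_mollify_smul hu hμ (hζ n) (hζc n) (hζt n) (φ n) x
  have hBcont : ∀ n, Continuous (B n) := fun n => (contDiff_mollify (φ n) (hg n)).continuous
  have hAcont : ∀ n, Continuous (A n) := fun n => by
    have : A n = fun x => gradient (w n) x - B n x := by
      ext1 x
      rw [hwgrad, add_sub_cancel_right]
    rw [this]
    exact (continuous_gradient (hw n)).sub (hBcont n)
  have hwz : ∀ N n, N + 2 ≤ n → ∀ x ∈ U N, w n x = 0 := fun N n hn x hx =>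
    mollify_eq_zero _ fun y hy => by
      rw [hζz N n hn x hx y (Metric.ball_subset_ball (hφρ n).le hy), mul_zero]
  have hζz' : ∀ N n, N + 2 ≤ n → ∀ x ∈ U N, ζ n x = 0 := fun N n hn x hx =>
    hζz N n hn x hx x (Metric.mem_ball_self (hρ n))
  -- The series is a finite sum on each set of the cover.
  let v : EuclideanSpace ℝ (Fin m) → ℝ := fun x => ∑' n, w n x
  have hv : ∀ N, ∀ x ∈ U N, v x = ∑ i ∈ Finset.range (N + 2), w i x := fun N x hx =>
    tsum_eq_sum fun n hn => hwz N n (by simpa using hn) x hx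
  have hvev : ∀ N, ∀ x ∈ U N, v =ᶠ[𝓝 x] fun y => ∑ i ∈ Finset.range (N + 2), w i y :=
    fun N x hx => by
      filter_upwards [(hU N).mem_nhds hx] with y hy using hv N y hy
  have hvu : ∀ x ∈ Ω, ‖v x - u x‖ₑ ≤ ∑' n, ‖w n x - u x * ζ n x‖ₑ := by
    intro x hx
    obtain ⟨N, hN⟩ := Set.mem_iUnion.1 (hUΩ hx)
    have : v x - u x = ∑ i ∈ Finset.range (N + 2), (w i x - u x * ζ i x) := by
      rw [Finset.sum_sub_distrib, ← Finset.mul_sum, hζ1 N x hN, mul_one, hv N x hN]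
    rw [this]
    exact (enorm_sum_le _ _).trans (ENNReal.sum_le_tsum _)
  have hvgrad : ∀ x ∈ Ω, ‖gradient v x‖ₑ ≤
      ∑' n, (‖A n x‖ₑ + ‖B n x - u x • gradient (ζ n) x‖ₑ) := by
    intro x hx
    obtain ⟨N, hN⟩ := Set.mem_iUnion.1 (hUΩ hx)
    have h1 : gradient v x = ∑ i ∈ Finset.range (N + 2), gradient (w i) x := by
      rw [← gradient_finset_sum _ fun i _ => (hw i).differentiable one_ne_zero x, gradient,
        (hvev N x hN).fderiv_eq, gradient]
    have h0 : ∑ i ∈ Finset.range (N + 2), gradient (ζ i) x = 0 := by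
      rw [← gradient_finset_sum _ fun i _ => (hζ' i).differentiable one_ne_zero x, gradient]
      have : (fun y => ∑ i ∈ Finset.range (N + 2), ζ i y) =ᶠ[𝓝 x] fun _ => 1 := by
        filter_upwards [(hU N).mem_nhds hN] with y hy using hζ1 N y hy
      rw [this.fderiv_eq]
      simp
    have h2 : gradient v x =
        ∑ i ∈ Finset.range (N + 2), (A i x + (B i x - u x • gradient (ζ i) x)) := by
      rw [h1, Finset.sum_add_distrib, Finset.sum_sub_distrib, ← Finset.smul_sum, h0, smul_zero,
        sub_zero, ← Finset.sum_add_distrib]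
      exact Finset.sum_congr rfl fun i _ => hwgrad i x
    rw [h2]
    exact (enorm_sum_le _ _).trans ((Finset.sum_le_sum fun i _ => enorm_add_le _ _).trans
      (ENNReal.sum_le_tsum _))
  have hζsum : ∫⁻ x, ∑' n, ‖ζ n x‖ₑ ∂μ.variation ≤ μ.variation Set.univ := by
    rw [← lintegral_one]
    refine lintegral_mono fun x => ?_
    by_cases hx : x ∈ Ω
    · obtain ⟨N, hN⟩ := Set.mem_iUnion.1 (hUΩ hx)
      rw [tsum_eq_sum (s := Finset.range (N + 2)) fun n hn => by
        rw [hζz' N n (by simpa using hn) x hN, enorm_zero]]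
      simp_rw [Real.enorm_of_nonneg (hζ0 _ x)]
      rw [← ENNReal.ofReal_sum_of_nonneg fun i _ => hζ0 i x, hζ1 N x hN, ENNReal.ofReal_one]
    · simp [hz _ x hx]
  refine ⟨v, fun x hx => ?_, ?_, ?_⟩
  · obtain ⟨N, hN⟩ := Set.mem_iUnion.1 (hUΩ hx)
    exact ((ContDiff.sum fun i _ => hw i).contDiffAt.congr_of_eventuallyEq
      (hvev N x hN)).contDiffWithinAt
  · calc ∫⁻ x in Ω, ‖v x - u x‖ₑ ≤ ∫⁻ x in Ω, ∑' n, ‖w n x - u x * ζ n x‖ₑ :=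
          setLIntegral_mono' hΩ.measurableSet hvu
      _ ≤ ∫⁻ x, ∑' n, ‖w n x - u x * ζ n x‖ₑ := setLIntegral_le_lintegral _ _
      _ = ∑' n, ∫⁻ x, ‖w n x - u x * ζ n x‖ₑ :=
          lintegral_tsum fun n => ((hw n).continuous.aestronglyMeasurable.sub (hf n).1).enorm
      _ ≤ ∑' n, (η n : ℝ≥0∞) := ENNReal.tsum_le_tsum hφ1
      _ ≤ ε := hη.le
  · have hmA : ∀ n, AEMeasurable fun x => ‖A n x‖ₑ := fun n =>
      (hAcont n).enorm.measurable.aemeasurable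
    have hmB : ∀ n, AEMeasurable fun x => ‖B n x - u x • gradient (ζ n) x‖ₑ := fun n =>
      ((hBcont n).aestronglyMeasurable.sub (hg n).1).enorm
    calc ∫⁻ x in Ω, ‖gradient v x‖ₑ
        ≤ ∫⁻ x in Ω, ∑' n, (‖A n x‖ₑ + ‖B n x - u x • gradient (ζ n) x‖ₑ) :=
          setLIntegral_mono' hΩ.measurableSet hvgrad
      _ ≤ ∫⁻ x, ∑' n, (‖A n x‖ₑ + ‖B n x - u x • gradient (ζ n) x‖ₑ) :=
          setLIntegral_le_lintegral _ _
      _ = ∑' n, ∫⁻ x, (‖A n x‖ₑ + ‖B n x - u x • gradient (ζ n) x‖ₑ) :=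
          lintegral_tsum fun n => (hmA n).add (hmB n)
      _ = ∑' n, ((∫⁻ x, ‖A n x‖ₑ) + ∫⁻ x, ‖B n x - u x • gradient (ζ n) x‖ₑ) :=
          tsum_congr fun n => lintegral_add_left' (hmA n) _
      _ ≤ ∑' n, ((∫⁻ x, ‖ζ n x‖ₑ ∂μ.variation) + η n) :=
          ENNReal.tsum_le_tsum fun n => add_le_add
            (lintegral_enorm_integral_mollifier_le (hζ n).continuous (φ n)) (hφ2 n)
      _ = (∫⁻ x, ∑' n, ‖ζ n x‖ₑ ∂μ.variation) + ∑' n, (η n : ℝ≥0∞) := by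
          rw [ENNReal.tsum_add, lintegral_tsum fun n =>
            (hζ n).continuous.enorm.measurable.aemeasurable]
      _ ≤ μ.variation Set.univ + ε := add_le_add hζsum hη.le

end MeyersSerrin

/-! ### Flattening near the zero level -/

section Primitive

variable {E : Type*} [NormedAddCommGroup E] [InnerProductSpace ℝ E] [CompleteSpace E]

lemma contDiff_primitive {ρ : ℝ → ℝ} (hρ : Continuous ρ) :
    ContDiff ℝ 1 fun s => ∫ t in (0 : ℝ)..s, ρ t := by
  refine contDiff_one_iff_deriv.2
    ⟨fun s => (hρ.integral_hasStrictDerivAt 0 s).hasDerivAt.differentiableAt, ?_⟩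
  have : deriv (fun s => ∫ t in (0 : ℝ)..s, ρ t) = ρ := funext fun s => hρ.deriv_integral _ 0 s
  rwa [this]

lemma gradient_comp {f : ℝ → ℝ} {f' : ℝ} {u : E → ℝ} {x : E} (hf : HasDerivAt f f' (u x))
    (hu : DifferentiableAt ℝ u x) : gradient (fun y => f (u y)) x = f' • gradient u x := by
  have h : HasFDerivAt (fun y => f (u y)) (f' • fderiv ℝ u x) x :=
    hf.comp_hasFDerivAt x hu.hasFDerivAt
  simp [gradient, h.fderiv]

end Primitive

section Flattening

/-- A cutoff on the line, vanishing on `[-δ, δ]` and equal to `1` outside of `[-2δ, 2δ]`. -/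
noncomputable def ramp (δ t : ℝ) : ℝ := max 0 (min 1 (|t| / δ - 1))

lemma continuous_ramp (δ : ℝ) : Continuous (ramp δ) := by unfold ramp; fun_prop

lemma ramp_mem (δ t : ℝ) : 0 ≤ ramp δ t ∧ ramp δ t ≤ 1 :=
  ⟨le_max_left _ _, max_le zero_le_one (min_le_left _ _)⟩

lemma ramp_eq_zero {δ t : ℝ} (hδ : 0 < δ) (ht : |t| ≤ δ) : ramp δ t = 0 := by
  have : |t| / δ ≤ 1 := (div_le_one hδ).2 ht
  exact max_eq_left ((min_le_right _ _).trans (by linarith))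

lemma ramp_eq_one {δ t : ℝ} (hδ : 0 < δ) (ht : 2 * δ ≤ |t|) : ramp δ t = 1 := by
  have : 2 ≤ |t| / δ := (le_div_iff₀ hδ).2 ht
  rw [ramp, min_eq_left (by linarith), max_eq_right zero_le_one]

/-- A `C¹` approximation of the identity of the line, constant on `[-δ, δ]`. -/
noncomputable def flatten (δ s : ℝ) : ℝ := ∫ t in (0 : ℝ)..s, ramp δ t

lemma hasDerivAt_flatten (δ s : ℝ) : HasDerivAt (flatten δ) (ramp δ s) s :=
  ((continuous_ramp δ).integral_hasStrictDerivAt 0 s).hasDerivAt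

lemma flatten_eq_zero {δ s : ℝ} (hδ : 0 < δ) (hs : |s| ≤ δ) : flatten δ s = 0 := by
  have h : ∀ t ∈ Set.uIcc 0 s, ramp δ t = 0 := fun t ht => by
    refine ramp_eq_zero hδ (le_trans ?_ hs)
    simpa using Set.abs_sub_left_of_mem_uIcc ht
  rw [flatten, intervalIntegral.integral_congr (g := fun _ => 0) h]
  simp

lemma flatten_sub (δ a b : ℝ) :
    (flatten δ b - b) - (flatten δ a - a) = ∫ t in a..b, (ramp δ t - 1) := by
  have hi : ∀ a b, IntervalIntegrable (ramp δ) volume a b := fun a b =>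
    (continuous_ramp δ).intervalIntegrable a b
  rw [intervalIntegral.integral_sub (hi a b) intervalIntegrable_const,
    intervalIntegral.integral_const, flatten, flatten,
    ← intervalIntegral.integral_interval_sub_left (hi 0 b) (hi 0 a)]
  simp
  ring

lemma abs_flatten_sub_sub_le (δ a b : ℝ) :
    |(flatten δ b - b) - (flatten δ a - a)| ≤ |b - a| := by
  rw [flatten_sub]
  have h : ∀ t ∈ Set.uIoc a b, ‖ramp δ t - 1‖ ≤ 1 := fun t _ => by
    rw [Real.norm_eq_abs, abs_le]
    constructor <;> linarith [(ramp_mem δ t).1, (ramp_mem δ t).2]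
  simpa using intervalIntegral.norm_integral_le_of_norm_le_const h

lemma abs_flatten_sub_le_abs (δ s : ℝ) : |flatten δ s - s| ≤ |s| := by
  simpa [flatten] using abs_flatten_sub_sub_le δ 0 s

lemma abs_flatten_sub_le {δ : ℝ} (hδ : 0 < δ) (s : ℝ) : |flatten δ s - s| ≤ 2 * δ := by
  have key : ∀ a, |a| = 2 * δ → (∀ t ∈ Set.uIcc a s, 2 * δ ≤ |t|) →
      |flatten δ s - s| ≤ 2 * δ := fun a ha h => by
    have h0 : (flatten δ s - s) - (flatten δ a - a) = 0 := by
      rw [flatten_sub, intervalIntegral.integral_congr (g := fun _ => 0) fun t ht => by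
        simp [ramp_eq_one hδ (h t ht)]]
      simp
    rw [sub_eq_zero.1 h0, ← ha]
    exact abs_flatten_sub_le_abs δ a
  rcases le_or_gt |s| (2 * δ) with hs | hs
  · exact (abs_flatten_sub_le_abs δ s).trans hs
  rcases lt_abs.1 hs with hs | hs
  · refine key (2 * δ) (abs_of_pos (by positivity)) fun t ht => ?_
    rw [Set.uIcc_of_le hs.le] at ht
    exact ht.1.trans (le_abs_self t)
  · refine key (-(2 * δ)) (by rw [abs_neg, abs_of_pos (by positivity)]) fun t ht => ?_
    rw [Set.uIcc_of_ge (by linarith)] at ht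
    exact (le_neg_of_le_neg ht.2).trans (neg_le_abs t)

variable {m : ℕ} {Ω : Set (EuclideanSpace ℝ (Fin m))} {v : EuclideanSpace ℝ (Fin m) → ℝ}

/-- `C¹` functions can be approximated in `L¹` by functions that vanish outside of a set of finite
measure, without increasing the gradient. -/
lemma exists_flat_approx (hΩ : IsOpen Ω) (hv : ContDiffOn ℝ 1 v Ω) (hint : IntegrableOn v Ω)
    {ε : ℝ≥0∞} (hε : ε ≠ 0) :
    ∃ (w : EuclideanSpace ℝ (Fin m) → ℝ) (S : Set (EuclideanSpace ℝ (Fin m))),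
      ContDiffOn ℝ 1 w Ω ∧ ∫⁻ x in Ω, ‖w x - v x‖ₑ ≤ ε ∧
      (∀ x ∈ Ω, ‖gradient w x‖ₑ ≤ ‖gradient v x‖ₑ) ∧ MeasurableSet S ∧ volume S < ⊤ ∧
      ∀ x ∈ Ω, x ∉ S → w x = 0 ∧ gradient w x = 0 := by
  have hlim : Tendsto (fun n : ℕ => ∫⁻ x in Ω, ‖flatten (1 / (n + 1)) (v x) - v x‖ₑ) atTop
      (𝓝 (∫⁻ _ in Ω, 0)) := by
    refine tendsto_lintegral_of_dominated_convergence' (fun x => ‖v x‖ₑ) (fun n => ?_)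
      (fun n => Eventually.of_forall fun x => ?_) hint.2.ne (Eventually.of_forall fun x => ?_)
    · have : Continuous (flatten (1 / (n + 1))) :=
        (contDiff_primitive (continuous_ramp _)).continuous
      exact ((this.comp_aestronglyMeasurable hint.1).sub hint.1).enorm
    · change ‖flatten (1 / (n + 1)) (v x) - v x‖ₑ ≤ ‖v x‖ₑ
      rw [← ofReal_norm, ← ofReal_norm]
      exact ENNReal.ofReal_le_ofReal (abs_flatten_sub_le_abs _ _)
    · have h1 : Tendsto (fun n : ℕ => ENNReal.ofReal (2 * (1 / ((n : ℝ) + 1)))) atTop (𝓝 0) := by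
        simpa using ENNReal.tendsto_ofReal
          ((tendsto_one_div_add_atTop_nhds_zero_nat (𝕜 := ℝ)).const_mul 2)
      refine tendsto_of_tendsto_of_tendsto_of_le_of_le tendsto_const_nhds h1
        (fun _ => zero_le) fun n => ?_
      rw [← ofReal_norm]
      exact ENNReal.ofReal_le_ofReal (abs_flatten_sub_le (by positivity) _)
  rw [lintegral_zero] at hlim
  obtain ⟨n, hn⟩ := (hlim.eventually_le_const (pos_iff_ne_zero.2 hε)).exists
  set δ : ℝ := 1 / ((n : ℝ) + 1) with hδ
  have hδ0 : 0 < δ := by positivity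
  have hd : ∀ x ∈ Ω, DifferentiableAt ℝ v x := fun x hx =>
    (hv.differentiableOn one_ne_zero).differentiableAt (hΩ.mem_nhds hx)
  have hgrad : ∀ x ∈ Ω, gradient (fun y => flatten δ (v y)) x = ramp δ (v x) • gradient v x :=
    fun x hx => gradient_comp (hasDerivAt_flatten δ (v x)) (hd x hx)
  have hSm : MeasurableSet (Ω ∩ v ⁻¹' {t | δ < |t|}) :=
    (hv.continuousOn.isOpen_inter_preimage hΩ
      (isOpen_lt continuous_const continuous_abs)).measurableSet
  refine ⟨fun x => flatten δ (v x), Ω ∩ v ⁻¹' {t | δ < |t|},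
    (contDiff_primitive (continuous_ramp δ)).comp_contDiffOn hv, hn, fun x hx => ?_, hSm, ?_,
    fun x hx hxS => ?_⟩
  · rw [hgrad x hx, enorm_smul]
    refine mul_le_of_le_one_left zero_le ?_
    rw [Real.enorm_of_nonneg (ramp_mem _ _).1]
    exact ENNReal.ofReal_le_one.2 (ramp_mem _ _).2
  · have := hint.measure_norm_gt_lt_top hδ0
    rw [Measure.restrict_apply' hΩ.measurableSet, Set.inter_comm] at this
    exact this
  · have hx' : |v x| ≤ δ := by
      by_contra h
      exact hxS ⟨hx, not_le.1 h⟩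
    rw [hgrad x hx, ramp_eq_zero hδ0 hx', zero_smul]
    exact ⟨flatten_eq_zero hδ0 hx', rfl⟩

end Flattening

/-! ### Steep staircases -/

section EnergyDensity

variable {φ : ℝ≥0 → ℝ≥0}

lemma IsEnergy.map_nat_mul_le (hφ : IsEnergy φ) (n : ℕ) (t : ℝ≥0) : φ (n * t) ≤ n * φ t := by
  induction n with
  | zero => simp [hφ.map_zero]
  | succ n ih =>
    push_cast
    rw [add_mul, add_mul, one_mul, one_mul]
    exact (hφ.subadditive _ _).trans (by gcongr)

lemma IsEnergy.le_linear (hφ : IsEnergy φ) (t : ℝ≥0) : φ t ≤ φ 1 * (t + 1) := by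
  calc φ t ≤ φ (⌈t⌉₊ * 1) := hφ.monotone (by simpa using Nat.le_ceil t)
    _ ≤ ⌈t⌉₊ * φ 1 := hφ.map_nat_mul_le _ _
    _ ≤ φ 1 * (t + 1) := by
      rw [mul_comm]
      gcongr
      exact (Nat.ceil_lt_add_one (zero_le)).le

/-- The concentration gain of a vanishing recession slope: slopes that are larger by the factor
`2 n` and are attained only on a fraction `2 / n` of the space cost less and less. -/
lemma IsEnergy.tendsto_concentrated (hφ : IsEnergy φ) (t : ℝ≥0) :
    Tendsto (fun n : ℕ => φ ((2 * (n + 1) : ℕ) * t) * (2 / ((n : ℝ≥0) + 1))) atTop (𝓝 0) := by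
  rcases eq_or_ne t 0 with rfl | ht
  · simp [hφ.map_zero]
  have h1 : Tendsto (fun n : ℕ => (((2 * (n + 1) : ℕ) : ℝ≥0) * t)) atTop atTop := by
    refine Tendsto.atTop_mul_const (pos_iff_ne_zero.2 ht) ?_
    exact tendsto_natCast_atTop_atTop.comp
      (tendsto_atTop_mono (fun n => show n ≤ 2 * (n + 1) by omega) tendsto_id)
  have h2 := (hφ.recession_zero.comp h1).mul_const (4 * t)
  rw [zero_mul] at h2
  refine h2.congr fun n => ?_
  have : (n : ℝ≥0) + 1 ≠ 0 := by positivity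
  simp only [Function.comp_apply]
  push_cast
  field_simp
  ring

end EnergyDensity

section Staircase

/-- Densities on the circle `ℝ / ℤ`, concentrated near `0`. -/
lemma exists_concentrated_density {k : ℕ} (hk : k ≠ 0) :
    ∃ ρ : UnitAddCircle → ℝ, Continuous ρ ∧ (∀ b, 0 ≤ ρ b) ∧ (∀ b, ρ b ≤ 2 * k) ∧
      ∫ b, ρ b = 1 ∧ volume (Function.support ρ) ≤ ENNReal.ofReal (2 / k) := by
  have hk0 : (0 : ℝ) < k := by positivity
  have hk1 : (1 : ℝ) ≤ k := by exact_mod_cast Nat.one_le_iff_ne_zero.2 hk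
  let g : UnitAddCircle → ℝ := fun b => max 0 (1 - k * ‖b‖)
  have hg : Continuous g := by fun_prop
  have hg0 : ∀ b, 0 ≤ g b := fun b => le_max_left _ _
  have hg1 : ∀ b, g b ≤ 1 := fun b => max_le zero_le_one (by
    have : 0 ≤ k * ‖b‖ := by positivity
    linarith)
  have hgi : Integrable g :=
    hg.integrable_of_hasCompactSupport (HasCompactSupport.of_compactSpace g)
  -- `g` is at least `1 / 2` on the ball of radius `1 / (2k)`, which has measure `1 / k`.
  have hlow : 1 / (2 * k : ℝ) ≤ ∫ b, g b := by
    have hmeas : MeasurableSet (Metric.closedBall (0 : UnitAddCircle) (1 / (2 * k))) :=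
      Metric.isClosed_closedBall.measurableSet
    have hvol : volume.real (Metric.closedBall (0 : UnitAddCircle) (1 / (2 * k))) = 1 / k := by
      rw [Measure.real, AddCircle.volume_closedBall, ENNReal.toReal_ofReal]
      · rw [min_eq_right]
        · field_simp
        · rw [mul_one_div, div_le_one (by positivity)]
          linarith
      · exact le_min zero_le_one (by positivity)
    calc 1 / (2 * k : ℝ)
        = ∫ _ in Metric.closedBall (0 : UnitAddCircle) (1 / (2 * k)), (1 / 2 : ℝ) := by
          rw [setIntegral_const, hvol, smul_eq_mul]
          field_simp
      _ ≤ ∫ b in Metric.closedBall (0 : UnitAddCircle) (1 / (2 * k)), g b := by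
          refine setIntegral_mono_on (integrableOn_const (by finiteness)) hgi.integrableOn hmeas
            fun b hb => le_max_of_le_right ?_
          have hb' : ‖b‖ ≤ 1 / (2 * k) := by simpa using hb
          have : k * ‖b‖ ≤ k * (1 / (2 * k)) := by gcongr
          have e : k * (1 / (2 * k)) = (1 / 2 : ℝ) := by field_simp
          linarith
      _ ≤ ∫ b, g b := setIntegral_le_integral hgi (Eventually.of_forall hg0)
  have hpos : 0 < ∫ b, g b := lt_of_lt_of_le (by positivity) hlow
  have hinv : (∫ b, g b)⁻¹ ≤ 2 * k := by
    rw [inv_le_comm₀ hpos (by positivity)]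
    simpa using hlow
  -- The bound `2k` is that of `1 / ∫ g`, as `g ≤ 1`.
  refine ⟨fun b => (∫ b, g b)⁻¹ * g b, by fun_prop,
    fun b => mul_nonneg (inv_nonneg.2 hpos.le) (hg0 b), fun b => ?_, ?_, ?_⟩
  · calc (∫ b, g b)⁻¹ * g b ≤ (2 * k) * 1 := by gcongr; exact hg1 b
      _ = 2 * k := mul_one _
  · rw [integral_const_mul, inv_mul_cancel₀ hpos.ne']
  · have hsub : (Function.support fun b => (∫ b, g b)⁻¹ * g b) ⊆
        Metric.closedBall (0 : UnitAddCircle) (1 / k) := fun b hb => by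
      by_contra h
      have h' : 1 / k < ‖b‖ := by simpa using h
      rw [div_lt_iff₀' hk0] at h'
      exact hb (by simp [g, max_eq_left (show 1 - k * ‖b‖ ≤ 0 by linarith)])
    refine (measure_mono hsub).trans ?_
    rw [AddCircle.volume_closedBall]
    refine ENNReal.ofReal_le_ofReal ((min_le_right _ _).trans_eq ?_)
    ring

/-- The primitive of `ρ (· - a)`, where `ρ` is a density on the circle `ℝ / ℤ`. When `ρ` is
concentrated near `0`, this is a staircase with steps of height and width `1`, climbing near the
points of `a + ℤ`; the subtraction takes place in `ℝ / ℤ`. -/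
noncomputable def staircase (ρ : UnitAddCircle → ℝ) (a : UnitAddCircle) (s : ℝ) : ℝ :=
  ∫ t in (0 : ℝ)..s, ρ (t - a)

variable {ρ : UnitAddCircle → ℝ}

lemma continuous_staircase_slope (hρ : Continuous ρ) (a : UnitAddCircle) :
    Continuous fun t : ℝ => ρ (t - a) :=
  hρ.comp ((AddCircle.continuous_mk' 1).sub continuous_const)

lemma hasDerivAt_staircase (hρ : Continuous ρ) (a : UnitAddCircle) (s : ℝ) :
    HasDerivAt (staircase ρ a) (ρ (s - a)) s :=
  ((continuous_staircase_slope hρ a).integral_hasStrictDerivAt 0 s).hasDerivAt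

/-- A staircase climbs exactly by `1` over each unit interval, so it stays close to the identity. -/
lemma abs_staircase_sub_le (hρ : Continuous ρ) (hρ0 : ∀ b, 0 ≤ ρ b) (hρ1 : ∫ b, ρ b = 1)
    (a : UnitAddCircle) (s : ℝ) : |staircase ρ a s - s| ≤ 1 := by
  have hc := continuous_staircase_slope hρ a
  have hi : ∀ t₁ t₂, IntervalIntegrable (fun t : ℝ => ρ (t - a)) volume t₁ t₂ :=
    fun _ _ => hc.intervalIntegrable _ _
  have hper : Function.Periodic (fun t : ℝ => ρ (t - a)) 1 := fun t => by simp
  have hone : ∀ t, ∫ τ in t..t + 1, ρ (τ - a) = 1 := fun t => by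
    rw [AddCircle.intervalIntegral_preimage 1 t fun b => ρ (b - a), integral_sub_right_eq_self, hρ1]
  have hfl : ∫ τ in (0 : ℝ)..⌊s⌋, ρ (τ - a) = ⌊s⌋ := by
    have := hper.intervalIntegral_add_zsmul_eq ⌊s⌋ 0 hi
    rw [hone] at this
    simpa using this
  have hsplit : staircase ρ a s = ⌊s⌋ + ∫ τ in (⌊s⌋ : ℝ)..s, ρ (τ - a) := by
    have h := intervalIntegral.integral_add_adjacent_intervals (hi 0 ⌊s⌋) (hi ⌊s⌋ s)
    rw [hfl] at h
    exact h.symm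
  have h0 : 0 ≤ ∫ τ in (⌊s⌋ : ℝ)..s, ρ (τ - a) :=
    intervalIntegral.integral_nonneg (Int.floor_le s) fun _ _ => hρ0 _
  have h1 : ∫ τ in (⌊s⌋ : ℝ)..s, ρ (τ - a) ≤ 1 := by
    refine le_trans ?_ (hone ⌊s⌋).le
    exact intervalIntegral.integral_mono_interval le_rfl (Int.floor_le s)
      (Int.lt_floor_add_one s).le (Eventually.of_forall fun _ => hρ0 _) (hi _ _)
  rw [hsplit, abs_le]
  constructor <;> linarith [Int.floor_le s, Int.lt_floor_add_one s]

variable {m : ℕ} {Ω : Set (EuclideanSpace ℝ (Fin m))} {w : EuclideanSpace ℝ (Fin m) → ℝ}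
  {φ : ℝ≥0 → ℝ≥0}

/-- Averaging over the offset: the total variation is unchanged. -/
lemma lintegral_enorm_slope_smul {F : Type*} [NormedAddCommGroup F] [NormedSpace ℝ F]
    (hρ : Continuous ρ) (hρ0 : ∀ b, 0 ≤ ρ b) (hρ1 : ∫ b, ρ b = 1) (s : UnitAddCircle) (g : F) :
    ∫⁻ a, ‖ρ (s - a) • g‖ₑ = ‖g‖ₑ := by
  have hi : Integrable ρ := hρ.integrable_of_hasCompactSupport (HasCompactSupport.of_compactSpace ρ)
  simp_rw [enorm_smul]
  rw [lintegral_sub_left_eq_self (fun b => ‖ρ b‖ₑ * ‖g‖ₑ), lintegral_mul_const' _ _ enorm_ne_top]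
  simp_rw [Real.enorm_of_nonneg (hρ0 _)]
  rw [← ofReal_integral_eq_lintegral_ofReal hi (Eventually.of_forall hρ0), hρ1,
    ENNReal.ofReal_one, one_mul]

/-- Averaging over the offset: the energy is only paid where the slope is non-zero. -/
lemma lintegral_energy_slope_smul_le {F : Type*} [NormedAddCommGroup F] [NormedSpace ℝ F]
    (hφ : IsEnergy φ) {k : ℕ} (hρ : Continuous ρ) (hρ0 : ∀ b, 0 ≤ ρ b) (hρk : ∀ b, ρ b ≤ 2 * k)
    (hρs : volume (Function.support ρ) ≤ ENNReal.ofReal (2 / k)) (s : UnitAddCircle) (g : F) :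
    ∫⁻ a, (φ ‖ρ (s - a) • g‖₊ : ℝ≥0∞) ≤ φ ((2 * k : ℕ) * ‖g‖₊) * ENNReal.ofReal (2 / k) := by
  rw [lintegral_sub_left_eq_self (fun b => (φ ‖ρ b • g‖₊ : ℝ≥0∞))]
  calc ∫⁻ b, (φ ‖ρ b • g‖₊ : ℝ≥0∞)
      ≤ ∫⁻ b, (Function.support ρ).indicator
          (fun _ => (φ ((2 * k : ℕ) * ‖g‖₊) : ℝ≥0∞)) b := by
        refine lintegral_mono fun b => ?_
        by_cases hb : b ∈ Function.support ρ
        · rw [Set.indicator_of_mem hb, ENNReal.coe_le_coe, nnnorm_smul]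
          refine hφ.monotone (mul_le_mul_left ?_ _)
          rw [← NNReal.coe_le_coe, coe_nnnorm, Real.norm_of_nonneg (hρ0 b)]
          simpa using hρk b
        · rw [Set.indicator_of_notMem hb, Function.notMem_support.1 hb]
          simp [hφ.map_zero]
    _ = φ ((2 * k : ℕ) * ‖g‖₊) * volume (Function.support ρ) :=
        lintegral_indicator_const hρ.isOpen_support.measurableSet _
    _ ≤ _ := by gcongr

/-- The averaged concentrated energies of a function with integrable gradient that vanishes
outside of a set of finite measure become arbitrarily small. -/
lemma exists_concentrated_energy_le (hφ : IsEnergy φ) {g : EuclideanSpace ℝ (Fin m) →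
    EuclideanSpace ℝ (Fin m)} (hg : IntegrableOn g Ω) {S : Set (EuclideanSpace ℝ (Fin m))}
    (hS : MeasurableSet S) (hSfin : volume S < ⊤) (hgS : ∀ x ∈ Ω, x ∉ S → g x = 0)
    (hΩ : MeasurableSet Ω) {ε : ℝ≥0∞} (hε : ε ≠ 0) :
    ∃ k : ℕ, k ≠ 0 ∧ ∫⁻ x in Ω, φ ((2 * k : ℕ) * ‖g x‖₊) * ENNReal.ofReal (2 / k) ≤ ε := by
  have hmeas : ∀ c : ℝ≥0, AEMeasurable (fun x => (φ (c * ‖g x‖₊) : ℝ≥0∞)) (volume.restrict Ω) :=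
    fun c => (hφ.continuous.measurable.comp_aemeasurable
      (hg.1.nnnorm.aemeasurable.const_mul c)).coe_nnreal_ennreal
  have hcast : ∀ n : ℕ, ENNReal.ofReal (2 / ((n + 1 : ℕ) : ℝ)) =
      ((2 / ((n : ℝ≥0) + 1) : ℝ≥0) : ℝ≥0∞) := fun n => by
    rw [← ENNReal.ofReal_coe_nnreal]
    push_cast
    rfl
  have hlim : Tendsto (fun n : ℕ => ∫⁻ x in Ω, φ ((2 * (n + 1) : ℕ) * ‖g x‖₊) *
      ENNReal.ofReal (2 / (n + 1 : ℕ))) atTop (𝓝 (∫⁻ _ in Ω, 0)) := by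
    -- Subadditivity gives the dominating function: `φ (2kt) * (2 / k) ≤ 4 φ t`.
    refine tendsto_lintegral_of_dominated_convergence' (fun x => 4 * φ ‖g x‖₊)
      (fun n => (hmeas _).mul_const _) (fun n => Eventually.of_forall fun x => ?_) ?_
      (Eventually.of_forall fun x => ?_)
    · have h := hφ.map_nat_mul_le (2 * (n + 1)) ‖g x‖₊
      have h' : φ ((2 * (n + 1) : ℕ) * ‖g x‖₊) * (2 / ((n : ℝ≥0) + 1)) ≤ 4 * φ ‖g x‖₊ := by
        calc φ ((2 * (n + 1) : ℕ) * ‖g x‖₊) * (2 / ((n : ℝ≥0) + 1))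
            ≤ ((2 * (n + 1) : ℕ) * φ ‖g x‖₊) * (2 / ((n : ℝ≥0) + 1)) := by gcongr
          _ = 4 * φ ‖g x‖₊ := by
            have : (n : ℝ≥0) + 1 ≠ 0 := by positivity
            push_cast
            field_simp
            ring
      change (φ ((2 * (n + 1) : ℕ) * ‖g x‖₊) : ℝ≥0∞) * ENNReal.ofReal (2 / (n + 1 : ℕ)) ≤
        4 * (φ ‖g x‖₊ : ℝ≥0∞)
      rw [hcast]
      exact_mod_cast h'
    · refine ne_of_lt ?_
      have hb : ∀ x ∈ Ω, (4 * φ ‖g x‖₊ : ℝ≥0∞) ≤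
          4 * φ 1 * (‖g x‖ₑ + S.indicator (fun _ => 1) x) := fun x hx => by
        by_cases hxS : x ∈ S
        · rw [Set.indicator_of_mem hxS, mul_assoc]
          gcongr
          rw [enorm_eq_nnnorm]
          exact_mod_cast hφ.le_linear ‖g x‖₊
        · simp [hgS x hx hxS, hφ.map_zero]
      calc ∫⁻ x in Ω, (4 * φ ‖g x‖₊ : ℝ≥0∞)
          ≤ ∫⁻ x in Ω, 4 * φ 1 * (‖g x‖ₑ + S.indicator (fun _ => 1) x) :=
            setLIntegral_mono' hΩ hb
        _ = 4 * φ 1 * ((∫⁻ x in Ω, ‖g x‖ₑ) + ∫⁻ x in Ω, S.indicator (fun _ => 1) x) := by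
            rw [lintegral_const_mul' _ _ (by finiteness), lintegral_add_left' hg.1.enorm]
        _ < ⊤ := by
            have h1 : ∫⁻ x in Ω, ‖g x‖ₑ < ⊤ := hg.2
            have h2 : ∫⁻ x in Ω, S.indicator (fun _ => (1 : ℝ≥0∞)) x < ⊤ := by
              rw [lintegral_indicator_const hS, one_mul]
              exact (Measure.restrict_apply_le _ _).trans_lt hSfin
            finiteness
    · have h := hφ.tendsto_concentrated ‖g x‖₊
      have h' := ENNReal.tendsto_coe.2 h
      simp_rw [hcast]
      simpa using h'
  rw [lintegral_zero] at hlim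
  obtain ⟨n, hn⟩ := (hlim.eventually_le_const (pos_iff_ne_zero.2 hε)).exists
  exact ⟨n + 1, n.succ_ne_zero, hn⟩

/-- Composition with a fine and steep staircase, at a well-chosen offset, makes the energy small
without increasing the total variation by more than `ε`. Averaging over all offsets leaves the
total variation unchanged and makes the energy small; hence a good offset exists. -/
lemma exists_staircase_approx (hφ : IsEnergy φ) (hΩ : IsOpen Ω) (hw : ContDiffOn ℝ 1 w Ω)
    (hgrad : IntegrableOn (gradient w) Ω) {S : Set (EuclideanSpace ℝ (Fin m))}
    (hS : MeasurableSet S) (hSfin : volume S < ⊤)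
    (hwS : ∀ x ∈ Ω, x ∉ S → w x = 0 ∧ gradient w x = 0) {ε : ℝ≥0∞} (hε : ε ≠ 0) (hε' : ε ≠ ⊤) :
    ∃ v : EuclideanSpace ℝ (Fin m) → ℝ, ContDiffOn ℝ 1 v Ω ∧ ∫⁻ x in Ω, ‖v x - w x‖ₑ ≤ ε ∧
      ∫⁻ x in Ω, ‖gradient v x‖ₑ ≤ (∫⁻ x in Ω, ‖gradient w x‖ₑ) + ε ∧
      smoothEnergy φ Ω v ≤ ε := by
  obtain ⟨h, hh0, hhS⟩ : ∃ h : ℝ, 0 < h ∧ ENNReal.ofReal h * volume S ≤ ε := by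
    obtain ⟨h, hh, H⟩ := ENNReal.exists_nnreal_pos_mul_lt hSfin.ne hε
    exact ⟨h, by exact_mod_cast hh, by simpa using H.le⟩
  set V := ∫⁻ x in Ω, ‖gradient w x‖ₑ with hV
  have hVfin : V < ⊤ := hgrad.2
  obtain ⟨N, hN⟩ := ENNReal.exists_nat_mul_gt hε (show V + ε ≠ ⊤ by finiteness)
  have hN0 : (N : ℝ≥0∞) ≠ 0 := fun h0 => by simp [h0] at hN
  obtain ⟨k, hk, hkε⟩ := exists_concentrated_energy_le hφ hgrad hS hSfin
    (fun x hx hxS => (hwS x hx hxS).2) hΩ.measurableSet (ε := ε / N)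
    (ENNReal.div_ne_zero.2 ⟨hε, ENNReal.natCast_ne_top N⟩)
  obtain ⟨ρ, hρ, hρ0, hρk, hρ1, hρs⟩ := exists_concentrated_density hk
  let G : UnitAddCircle → EuclideanSpace ℝ (Fin m) → EuclideanSpace ℝ (Fin m) := fun a x =>
    ρ ((w x / h : ℝ) - a) • gradient w x
  have hwm : AEMeasurable w (volume.restrict Ω) :=
    hw.continuousOn.aemeasurable hΩ.measurableSet
  have hGm : AEStronglyMeasurable (fun p : EuclideanSpace ℝ (Fin m) × UnitAddCircle => G p.2 p.1)
      ((volume.restrict Ω).prod volume) := by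
    have h0 : AEStronglyMeasurable (fun p : EuclideanSpace ℝ (Fin m) × UnitAddCircle =>
        gradient w p.1) ((volume.restrict Ω).prod volume) := hgrad.1.comp_fst
    have h1 : AEMeasurable (fun p : EuclideanSpace ℝ (Fin m) × UnitAddCircle =>
        ((w p.1 / h : ℝ) : UnitAddCircle) - p.2) ((volume.restrict Ω).prod volume) :=
      ((AddCircle.continuous_mk' 1).measurable.comp_aemeasurable
        (hwm.comp_fst.div_const h)).sub measurable_snd.aemeasurable
    have h2 : AEStronglyMeasurable (fun p : EuclideanSpace ℝ (Fin m) × UnitAddCircle =>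
        ρ ((w p.1 / h : ℝ) - p.2)) ((volume.restrict Ω).prod volume) :=
      (hρ.measurable.comp_aemeasurable h1).aestronglyMeasurable
    exact h2.smul h0
  have hEm : AEMeasurable (fun p : EuclideanSpace ℝ (Fin m) × UnitAddCircle =>
      (φ ‖G p.2 p.1‖₊ : ℝ≥0∞)) ((volume.restrict Ω).prod volume) :=
    (hφ.continuous.measurable.comp_aemeasurable hGm.nnnorm.aemeasurable).coe_nnreal_ennreal
  have hprob : IsProbabilityMeasure (volume : Measure UnitAddCircle) :=
    ⟨by rw [AddCircle.measure_univ, ENNReal.ofReal_one]⟩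
  -- The first moment method on the circle of offsets.
  obtain ⟨a, ha⟩ : ∃ a, (∫⁻ x in Ω, ‖G a x‖ₑ) + N * ∫⁻ x in Ω, (φ ‖G a x‖₊ : ℝ≥0∞) ≤ V + ε := by
    have m1 : AEMeasurable (fun a => ∫⁻ x in Ω, ‖G a x‖ₑ) (volume : Measure UnitAddCircle) :=
      hGm.enorm.lintegral_prod_left'
    have m2 : AEMeasurable (fun a => ∫⁻ x in Ω, (φ ‖G a x‖₊ : ℝ≥0∞))
      (volume : Measure UnitAddCircle) := hEm.lintegral_prod_left'
    obtain ⟨a, ha⟩ := exists_le_lintegral (m1.add (m2.const_mul (N : ℝ≥0∞)))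
    refine ⟨a, ha.trans ?_⟩
    simp only [Pi.add_apply]
    rw [lintegral_add_left' m1, lintegral_const_mul' _ _ (ENNReal.natCast_ne_top N)]
    refine add_le_add ?_ ?_
    · rw [← lintegral_lintegral_swap (f := fun x a => ‖G a x‖ₑ) hGm.enorm]
      simp only [G, lintegral_enorm_slope_smul hρ hρ0 hρ1]
      exact le_rfl
    · rw [← lintegral_lintegral_swap (f := fun x a => (φ ‖G a x‖₊ : ℝ≥0∞)) hEm]
      calc N * ∫⁻ x in Ω, ∫⁻ a, (φ ‖G a x‖₊ : ℝ≥0∞) ≤ N * (ε / N) := by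
            gcongr
            exact (lintegral_mono fun x =>
              lintegral_energy_slope_smul_le hφ hρ hρ0 hρk hρs _ _).trans hkε
        _ ≤ ε := ENNReal.mul_div_le
  have hd : ∀ x ∈ Ω, DifferentiableAt ℝ w x := fun x hx =>
    (hw.differentiableOn one_ne_zero).differentiableAt (hΩ.mem_nhds hx)
  have hderiv : ∀ s, HasDerivAt (fun s => h * staircase ρ a (s / h)) (ρ ((s / h : ℝ) - a)) s :=
    fun s => by
      have := ((hasDerivAt_staircase hρ a (s / h)).comp s
        ((hasDerivAt_id s).div_const h)).const_mul h
      refine this.congr_deriv ?_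
      field_simp
  have hvgrad : ∀ x ∈ Ω, gradient (fun y => h * staircase ρ a (w y / h)) x = G a x :=
    fun x hx => gradient_comp (hderiv (w x)) (hd x hx)
  have hsmooth : ContDiff ℝ 1 (staircase ρ a) :=
    contDiff_primitive (continuous_staircase_slope hρ a)
  refine ⟨fun x => h * staircase ρ a (w x / h), ?_, ?_, ?_, ?_⟩
  · exact contDiffOn_const.mul (hsmooth.comp_contDiffOn (hw.div_const h))
  · calc ∫⁻ x in Ω, ‖h * staircase ρ a (w x / h) - w x‖ₑ
        ≤ ∫⁻ x in Ω, S.indicator (fun _ => ENNReal.ofReal h) x := by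
          refine setLIntegral_mono' hΩ.measurableSet fun x hx => ?_
          by_cases hxS : x ∈ S
          · rw [Set.indicator_of_mem hxS, ← ofReal_norm]
            refine ENNReal.ofReal_le_ofReal ?_
            have e : h * staircase ρ a (w x / h) - w x =
                h * (staircase ρ a (w x / h) - w x / h) := by field_simp
            rw [e, norm_mul, Real.norm_of_nonneg hh0.le]
            exact mul_le_of_le_one_right hh0.le (abs_staircase_sub_le hρ hρ0 hρ1 a _)
          · simp [(hwS x hx hxS).1, staircase]
      _ ≤ ENNReal.ofReal h * volume S := by
          rw [lintegral_indicator_const hS]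
          gcongr
          exact Measure.restrict_le_self
      _ ≤ ε := hhS
  · rw [setLIntegral_congr_fun hΩ.measurableSet fun x hx => by rw [hvgrad x hx]]
    exact le_self_add.trans ha
  · rw [smoothEnergy, setLIntegral_congr_fun hΩ.measurableSet fun x hx => by rw [hvgrad x hx]]
    have h1 : N * ∫⁻ x in Ω, (φ ‖G a x‖₊ : ℝ≥0∞) ≤ N * ε := (le_add_self.trans ha).trans hN.le
    exact (ENNReal.mul_le_mul_iff_right hN0 (ENNReal.natCast_ne_top N)).1 h1

end Staircase

/-! ### Vanishing of the relaxed energy -/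

section Approximation

variable {m : ℕ} {Ω : Set (EuclideanSpace ℝ (Fin m))} {u v : EuclideanSpace ℝ (Fin m) → ℝ}
  {φ : ℝ≥0 → ℝ≥0} {μ : VectorMeasure (EuclideanSpace ℝ (Fin m)) (EuclideanSpace ℝ (Fin m))}

lemma integrableOn_of_lintegral_sub_lt_top (hΩ : IsOpen Ω) (hv : ContinuousOn v Ω)
    (hu : IntegrableOn u Ω) (hvu : ∫⁻ x in Ω, ‖v x - u x‖ₑ < ⊤) : IntegrableOn v Ω := by
  have h : IntegrableOn (fun x => v x - u x) Ω :=
    ⟨(hv.aestronglyMeasurable hΩ.measurableSet).sub hu.1, hvu⟩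
  exact (h.add hu).congr (Eventually.of_forall fun x => by simp)

/-- The approximation of `u` by smooth functions, made flat outside of a set of finite measure and
then composed with a steep staircase. -/
lemma exists_smooth_low_energy (hφ : IsEnergy φ) (hΩ : IsOpen Ω) (hu : IntegrableOn u Ω)
    (hμ : IsGradientMeasure Ω u μ) {ε : ℝ≥0∞} (hε : ε ≠ 0) (hε' : ε ≠ ⊤) :
    ∃ v : EuclideanSpace ℝ (Fin m) → ℝ, ContDiffOn ℝ 1 v Ω ∧
      ∫⁻ x in Ω, ‖v x - u x‖ₑ ≤ 3 * ε ∧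
      ∫⁻ x in Ω, ‖gradient v x‖ₑ ≤ μ.variation Set.univ + 2 * ε ∧
      smoothEnergy φ Ω v ≤ ε := by
  obtain ⟨v₁, hv₁, h₁, hg₁⟩ := exists_contDiffOn_approx hΩ hu hμ hε
  have hi₁ : IntegrableOn v₁ Ω := integrableOn_of_lintegral_sub_lt_top hΩ hv₁.continuousOn hu
    (h₁.trans_lt hε'.lt_top)
  obtain ⟨v₂, S, hv₂, h₂, hg₂, hS, hSfin, hv₂S⟩ := exists_flat_approx hΩ hv₁ hi₁ hε
  have hg₂' : ∫⁻ x in Ω, ‖gradient v₂ x‖ₑ ≤ μ.variation Set.univ + ε :=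
    (setLIntegral_mono' hΩ.measurableSet hg₂).trans hg₁
  have hfin : μ.variation Set.univ + ε < ⊤ := by
    have := hμ.finite
    finiteness
  obtain ⟨v₃, hv₃, h₃, hg₃, hE⟩ := exists_staircase_approx hφ hΩ hv₂
    (integrableOn_gradient hΩ hv₂ (hg₂'.trans_lt hfin)) hS hSfin hv₂S hε hε'
  refine ⟨v₃, hv₃, ?_, ?_, hE⟩
  · have m₁ : AEMeasurable (fun x => ‖v₁ x - u x‖ₑ) (volume.restrict Ω) := (hi₁.sub hu).1.enorm
    have m₂ : AEMeasurable (fun x => ‖v₂ x - v₁ x‖ₑ) (volume.restrict Ω) :=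
      ((hv₂.continuousOn.aestronglyMeasurable hΩ.measurableSet).sub hi₁.1).enorm
    calc ∫⁻ x in Ω, ‖v₃ x - u x‖ₑ
        ≤ ∫⁻ x in Ω, (‖v₃ x - v₂ x‖ₑ + ‖v₂ x - v₁ x‖ₑ + ‖v₁ x - u x‖ₑ) := by
          refine lintegral_mono fun x => ?_
          have : v₃ x - u x = (v₃ x - v₂ x) + (v₂ x - v₁ x) + (v₁ x - u x) := by ring
          rw [this]
          exact (enorm_add_le _ _).trans (by gcongr; exact enorm_add_le _ _)
      _ = (∫⁻ x in Ω, ‖v₃ x - v₂ x‖ₑ) + (∫⁻ x in Ω, ‖v₂ x - v₁ x‖ₑ) +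
            ∫⁻ x in Ω, ‖v₁ x - u x‖ₑ := by
          rw [lintegral_add_right' _ m₁, lintegral_add_right' _ m₂]
      _ ≤ ε + ε + ε := add_le_add (add_le_add h₃ h₂) h₁
      _ = 3 * ε := by ring
  · calc ∫⁻ x in Ω, ‖gradient v₃ x‖ₑ ≤ (∫⁻ x in Ω, ‖gradient v₂ x‖ₑ) + ε := hg₃
      _ ≤ (μ.variation Set.univ + ε) + ε := by gcongr
      _ = μ.variation Set.univ + 2 * ε := by ring

end Approximation

end TVphi

theorem theorem4p2 (m : ℕ) (φ : ℝ≥0 → ℝ≥0) (hφ : TVphi.IsEnergy φ)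
    (Ω : Set (EuclideanSpace ℝ (Fin m))) (hΩ : IsOpen Ω) (hLip : TVphi.HasLipschitzBoundary Ω)
    (u : EuclideanSpace ℝ (Fin m) → ℝ) (hu : TVphi.IsBV Ω u) :
    TVphi.TVc φ Ω u = 0 := by
  obtain ⟨hint, μ, hμ⟩ := hu
  have happrox : ∀ n : ℕ, ∃ v : EuclideanSpace ℝ (Fin m) → ℝ, ContDiffOn ℝ 1 v Ω ∧
      ∫⁻ x in Ω, ‖v x - u x‖ₑ ≤ 3 * ((n : ℝ≥0∞) + 1)⁻¹ ∧
      ∫⁻ x in Ω, ‖gradient v x‖ₑ ≤ μ.variation Set.univ + 2 ∧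
      TVphi.smoothEnergy φ Ω v ≤ ((n : ℝ≥0∞) + 1)⁻¹ := by
    intro n
    obtain ⟨v, hv, h1, h2, h3⟩ := TVphi.exists_smooth_low_energy hφ hΩ hint hμ
      (ε := ((n : ℝ≥0∞) + 1)⁻¹) (ENNReal.inv_ne_zero.2 (by finiteness)) (by simp)
    refine ⟨v, hv, h1, h2.trans ?_, h3⟩
    gcongr
    exact mul_le_of_le_one_right zero_le (ENNReal.inv_le_one.2 le_add_self)
  choose v hv hvu hvgrad hvE using happrox
  have hinv : Tendsto (fun n : ℕ => ((n : ℝ≥0∞) + 1)⁻¹) atTop (𝓝 0) := by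
    have := (tendsto_add_atTop_iff_nat 1).2 ENNReal.tendsto_inv_nat_nhds_zero
    simpa using this
  have hlim : Tendsto (fun n => ∫⁻ x in Ω, ‖v n x - u x‖ₑ) atTop (𝓝 0) := by
    refine tendsto_of_tendsto_of_tendsto_of_le_of_le tendsto_const_nhds ?_
      (fun _ => zero_le) hvu
    simpa using ENNReal.Tendsto.const_mul hinv (Or.inr (by finiteness : (3 : ℝ≥0∞) ≠ ⊤))
  have hCfin : μ.variation Set.univ + 2 < ⊤ := by
    have := hμ.finite
    finiteness
  have hvint : ∀ n, IntegrableOn (v n) Ω := fun n =>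
    TVphi.integrableOn_of_lintegral_sub_lt_top hΩ (hv n).continuousOn hint
      ((hvu n).trans_lt (by finiteness))
  have hgint : ∀ n, IntegrableOn (gradient (v n)) Ω := fun n =>
    TVphi.integrableOn_gradient hΩ (hv n) ((hvgrad n).trans_lt hCfin)
  have hν := fun n => TVphi.isGradientMeasure_withDensityᵥ hΩ (hv n) (hvint n) (hgint n)
  have hweak : TVphi.WeakStarTendsto Ω v u := by
    refine ⟨hvint, hint, ?_, _, μ, hν, hμ, ?_⟩
    · simpa only [eLpNorm_one_eq_lintegral_enorm, Pi.sub_apply] using hlim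
    · exact TVphi.tendsto_integral_gradientMeasure hvint hint hlim hν hμ hCfin.ne fun n => by
        rw [TVphi.variation_withDensityᵥ_gradient_univ (hgint n)]
        exact hvgrad n
  have hE : Tendsto (fun n => TVphi.smoothEnergy φ Ω (v n)) atTop (𝓝 0) :=
    tendsto_of_tendsto_of_tendsto_of_le_of_le tendsto_const_nhds hinv (fun _ => zero_le) hvE
  refine le_antisymm ?_ zero_le
  unfold TVphi.TVc
  refine iInf_le_of_le v (iInf_le_of_le hv (iInf_le_of_le hweak ?_))
  exact hE.liminf_eq.le
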